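/- Let $1\le n\le n_r$ be integers and $P,C_L>0$; $\log$ denotes the base-2 logarithm. For a $k$-tuple $X=(X_1,\dots,X_k)\in M_{n\times nk}(\mathbb{C})$ of complex $n\times n$ matrices let $\|X\|$ be the Frobenius norm and $\mathrm{pdet}(X)=\prod_{i=1}^k\det X_i$. For a $2n^2k$-dimensional lattice $L\subset M_{n\times nk}(\mathbb{C})$ let $\mathrm{Vol}(L)$ be the volume of its fundamental parallelotope (the square root of the Gram determinant for the inner product $\Re\,\mathrm{Tr}(XY^\dagger)$) and $\mathrm{mindet}(L)=\inf_{0\ne X\in L}|\mathrm{pdet}(X)|$. Let $L_{n,k}$, with $k$ ranging over a set $\mathcal{K}$ of positive integers (typically infinite), be $2n^2k$-dimensional lattices with $$\mathrm{mindet}(L_{n,k})=1,\qquad \mathrm{Vol}(L_{n,k})^{1/(n^2k)}\le C_L\qquad(k\in\mathcal{K}).$$ Consider the i.i.d. Rayleigh block fading channel $Y_i=H_iX_i+W_i$, $i=1,\dots,k$, where $H_i,W_i\in M_{n_r\times n}(\mathbb{C})$ have independent circularly symmetric complex Gaussian entries with mean $0$ and variance $1$ per complex dimension, all $H_i$ and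 $W_i$ are independent, and the receiver knows $H=(H_1,\dots,H_k)$. For $R\in\mathbb{R}$ and a shift $X_R\in M_{n\times nk}(\mathbb{C})$ consider the code $$\mathcal{C}_k=\{X\in X_R+\alpha L_{n,k}:\ \|X\|\le\sqrt{Pnk}\},\qquad \alpha^2=\frac{C_{n,k}^{1/(n^2k)}\,P}{2^{R/n}\,\mathrm{Vol}(L_{n,k})^{1/(n^2k)}},\quad C_{n,k}=\frac{(\pi nk)^{n^2k}}{(n^2k)!},$$ all of whose codewords satisfy the power constraint $\frac1{nk}\|X\|^2\le P$. 1. For a random matrix $H\in M_{n_r\times n}(\mathbb{C})$ with the above law, $\log\det\left(\frac Pn H^\dagger H\right)$ is integrable and $$\mathbb{E}_H\left[\log\det\left(\tfrac Pn H^\dagger H\right)\right]=n\log\left(\frac Pn\,e^{\frac1n\sum_{i=n_r-n+1}^{n_r}\psi(i)}\right),$$ where $\psi(x)=\frac{d}{dx}\ln\Gamma(x)$ is the digamma function. 2. Every rate $$R<\mathbb{E}_H\left[\log\det\left(\tfrac Pn H^\dagger H\right)\right]-n\log C_L+n\log\frac{\pi e}{4n}$$ is achieved by these codes, with exponentially vanishing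 error probability: for every $k\in\mathcal{K}$ the shift $X_R$ can be chosen so that $\mathcal{C}_k$ is finite with $|\mathcal{C}_k|\ge 2^{Rnk}$; and there are constants $A$ and $c>0$ such that for all $k\in\mathcal{K}$ and all shifts $X_R$, the probability of decoding incorrectly is at most $Ae^{-ck}$ for every transmitted codeword of $\mathcal{C}_k$, both with maximum likelihood decoding in $\mathcal{C}_k$ and with naive lattice decoding (closest point search in the whole shifted lattice $X_R+\alpha L_{n,k}$), whatever the rule for breaking ties. -/

import Mathlib

open MeasureTheory ProbabilityTheory
open scoped Matrix ENNReal

noncomputable section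

namespace Multiblock

/-- A `k`-tuple `(X₁, …, X_k)` of complex `m × n` matrices, one for each fading block. For `m = n`
this is the space of multiblock codewords `M_{n × nk}(ℂ)`. -/
abbrev Blocks (m n k : ℕ) : Type := Fin k → Matrix (Fin m) (Fin n) ℂ

/-- The real inner product `Re Tr (X Y†)` on `M_{n × nk}(ℂ)`. -/
def frobInner {m n k : ℕ} (X Y : Blocks m n k) : ℝ :=
  (∑ i, (X i * (Y i)ᴴ).trace).re

/-- The squared Frobenius norm `‖X‖²`. -/
def frobSq {m n k : ℕ} (X : Blocks m n k) : ℝ :=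
  ∑ i, ∑ a, ∑ b, ‖X i a b‖ ^ 2

/-- The product determinant `det X₁ ⋯ det X_k`. -/
def pdet {n k : ℕ} (X : Blocks n n k) : ℂ :=
  ∏ i, (X i).det

/-- A `2n²k`-dimensional matrix lattice in `M_{n × nk}(ℂ)`, given by a lattice basis: `2n²k` matrices
that are linearly independent over `ℝ`. -/
structure FullLattice (n k : ℕ) where
  basis : Fin (2 * n ^ 2 * k) → Blocks n n k
  linearIndependent : LinearIndependent ℝ basis

/-- The lattice `ℤ B₁ ⊕ ⋯ ⊕ ℤ B_r` as a subgroup. -/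
def FullLattice.points {n k : ℕ} (L : FullLattice n k) : Submodule ℤ (Blocks n n k) :=
  Submodule.span ℤ (Set.range L.basis)

/-- The volume of the fundamental parallelotope: the square root of the Gram determinant. -/
def FullLattice.vol {n k : ℕ} (L : FullLattice n k) : ℝ :=
  √|(Matrix.of fun i j => frobInner (L.basis i) (L.basis j)).det|

/-- The minimum determinant: the infimum of `|pdet X|` over the nonzero lattice points. -/
def FullLattice.mindet {n k : ℕ} (L : FullLattice n k) : ℝ :=
  sInf {t : ℝ | ∃ X ∈ L.points, X ≠ 0 ∧ t = ‖pdet X‖}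

/-- The constant `C_{n,k} = (π n k)^{n²k} / (n²k)!`; the ball of radius `√(Pkn)` in `M_{n × nk}(ℂ)`
has volume `C_{n,k} P^{n²k}`. -/
def ballConst (n k : ℕ) : ℝ :=
  (Real.pi * n * k) ^ (n ^ 2 * k) / (Nat.factorial (n ^ 2 * k) : ℝ)

/-- The scaling `α`, with `α² = C_{n,k}^{1/(n²k)} P / (2^{R/n} Vol(L)^{1/(n²k)})`. -/
def FullLattice.scale {n k : ℕ} (L : FullLattice n k) (P R : ℝ) : ℝ :=
  √(ballConst n k ^ (1 / ((n : ℝ) ^ 2 * k)) * P /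
    ((2 : ℝ) ^ (R / n) * L.vol ^ (1 / ((n : ℝ) ^ 2 * k))))

/-- The shifted and scaled lattice `X_R + α L`. -/
def FullLattice.coset {n k : ℕ} (L : FullLattice n k) (P R : ℝ) (shift : Blocks n n k) :
    Set (Blocks n n k) :=
  {X | ∃ Z ∈ L.points, X = shift + L.scale P R • Z}

/-- The finite code `B(√(Pkn)) ∩ (X_R + α L)`. -/
def FullLattice.code {n k : ℕ} (L : FullLattice n k) (P R : ℝ) (shift : Blocks n n k) :
    Set (Blocks n n k) :=
  {X | √(frobSq X) ≤ √(P * k * n)} ∩ L.coset P R shift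

/-- The power constraint `‖X‖² / (nk) ≤ P` for every codeword `X`. -/
def PowerConstraint {n k : ℕ} (P : ℝ) (C : Set (Blocks n n k)) : Prop :=
  ∀ X ∈ C, 1 / ((n : ℝ) * k) * frobSq X ≤ P

/-- The code `C` is finite and has rate at least `R` bits per channel use: `|C| ≥ 2^{Rnk}`. -/
def RateAtLeast {n k : ℕ} (R : ℝ) (C : Set (Blocks n n k)) : Prop :=
  C.Finite ∧ (2 : ℝ) ^ (R * n * k) ≤ (C.ncard : ℝ)

/-- The circularly symmetric complex Gaussian law with mean zero and unit variance per complex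
dimension: independent real and imaginary parts, each of variance `1/2`. -/
def complexGaussian : Measure ℂ :=
  ((gaussianReal 0 (1 / 2)).prod (gaussianReal 0 (1 / 2))).map
    (fun p : ℝ × ℝ => (⟨p.1, p.2⟩ : ℂ))

instance (m n : ℕ) : MeasurableSpace (Matrix (Fin m) (Fin n) ℂ) :=
  inferInstanceAs (MeasurableSpace (Fin m → Fin n → ℂ))

/-- The law of an `m × n` random matrix with independent entries of law `complexGaussian`. -/
def gaussianMatrix (m n : ℕ) : Measure (Matrix (Fin m) (Fin n) ℂ) :=
  (Measure.pi fun _ : Fin m => Measure.pi fun _ : Fin n => complexGaussian :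
    Measure (Fin m → Fin n → ℂ))

/-- The law of `k` independent such matrices. -/
def gaussianBlocks (m n k : ℕ) : Measure (Blocks m n k) :=
  Measure.pi fun _ : Fin k => gaussianMatrix m n

/-- The joint law of fading `H = (H₁, …, H_k)` and noise `W = (W₁, …, W_k)` for the i.i.d. Rayleigh
block fading channel: both are Gaussian, and they are independent. -/
def rayleighChannel (n nr k : ℕ) : Measure (Blocks nr n k × Blocks nr n k) :=
  (gaussianBlocks nr n k).prod (gaussianBlocks nr n k)

/-- The received signal `Y_i = H_i X_i + W_i`. -/
def received {n nr k : ℕ} (H : Blocks nr n k) (X : Blocks n n k) (W : Blocks nr n k) :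
    Blocks nr n k :=
  fun i => H i * X i + W i

/-- The squared distance `∑ ‖Y_i - H_i X_i‖²`. -/
def distSq {n nr k : ℕ} (H Y : Blocks nr n k) (X : Blocks n n k) : ℝ :=
  frobSq fun i => Y i - H i * X i

/-- The likelihood of `X`: the conditional density of the output `Y` given the input `X` and the
fading `H`, the noise entries having density `π⁻¹ exp(-|w|²)`. -/
def likelihood {n nr k : ℕ} (H Y : Blocks nr n k) (X : Blocks n n k) : ℝ :=
  ∏ i, ∏ a, ∏ b, (1 / Real.pi * Real.exp (-‖Y i a b - (H i * X i) a b‖ ^ 2))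

/-- A decoder sees the fading `H` and the output `Y`. -/
abbrev Decoder (n nr k : ℕ) : Type := Blocks nr n k → Blocks nr n k → Blocks n n k

/-- `dec` is a maximum likelihood decoder for `C` (with any rule for breaking ties). -/
def IsMLDecoder {n nr k : ℕ} (C : Set (Blocks n n k)) (dec : Decoder n nr k) : Prop :=
  ∀ H Y, dec H Y ∈ C ∧ ∀ X ∈ C, likelihood H Y X ≤ likelihood H Y (dec H Y)

/-- `dec` is a naive lattice decoder: a closest point search in the infinite set `Λ` (a shifted
lattice), ignoring the boundary of the code. It is unconstrained for those `H, Y` for which there is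
no closest point, which happens only if some `H_i` is rank deficient. -/
def IsNaiveDecoder {n nr k : ℕ} (Λ : Set (Blocks n n k)) (dec : Decoder n nr k) : Prop :=
  ∀ H Y, (∃ X ∈ Λ, ∀ X' ∈ Λ, distSq H Y X ≤ distSq H Y X') →
    dec H Y ∈ Λ ∧ ∀ X' ∈ Λ, distSq H Y (dec H Y) ≤ distSq H Y X'

/-- The (maximal) error probability of the code `C` with decoder `dec` over the Rayleigh channel: the
supremum over the transmitted codewords `X` of the probability that the output is not decoded
to `X`. -/
def errorProb {n nr k : ℕ} (C : Set (Blocks n n k)) (dec : Decoder n nr k) : ℝ≥0∞ :=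
  ⨆ X ∈ C, rayleighChannel n nr k {p | dec p.1 (received p.1 X p.2) ≠ X}

/-- The digamma function `ψ(x) = d/dx ln Γ(x)`. -/
def digamma (x : ℝ) : ℝ := deriv (fun t : ℝ => Real.log (Real.Gamma t)) x

/-- `log₂ det ((P/n) H† H)`. -/
def logDet {n nr : ℕ} (P : ℝ) (H : Matrix (Fin nr) (Fin n) ℂ) : ℝ :=
  Real.logb 2 (((P / n : ℝ) • (Hᴴ * H)).det).re

end Multiblock

end

open MeasureTheory ProbabilityTheory
open scoped Matrix ENNReal

noncomputable section

namespace Multiblock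

/-- `μ` is the probability measure with density proportional to `exp (-q)` with respect to a Haar
measure. -/
structure IsGaussDensity {E : Type*} [NormedAddCommGroup E] [MeasurableSpace E]
    (μ : Measure E) (q : E → ℝ) : Prop where
  prob : IsProbabilityMeasure μ
  measurable : Measurable q
  density : ∃ ν : Measure E, ν.IsAddHaarMeasure ∧
    μ = ν.withDensity fun x => ENNReal.ofReal (Real.exp (-q x))

section General

variable {E F : Type*} [NormedAddCommGroup E] [NormedSpace ℝ E] [MeasurableSpace E] [BorelSpace E]
  [FiniteDimensional ℝ E] [NormedAddCommGroup F] [NormedSpace ℝ F] [MeasurableSpace F]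
  [BorelSpace F] [FiniteDimensional ℝ F]

theorem IsGaussDensity.unique {μ μ' : Measure E} {q : E → ℝ} (h : IsGaussDensity μ q)
    (h' : IsGaussDensity μ' q) : μ = μ' := by
  obtain ⟨ν, hν, rfl⟩ := h.density
  obtain ⟨ν', hν', rfl⟩ := h'.density
  have hprob := h.prob
  have hprob' := h'.prob
  have e := Measure.isAddLeftInvariant_eq_smul ν' ν
  set r := ν'.addHaarScalarFactor ν with hr
  have e2 : ν'.withDensity (fun x => ENNReal.ofReal (Real.exp (-q x)))
      = (r : ℝ≥0∞) • ν.withDensity (fun x => ENNReal.ofReal (Real.exp (-q x))) := by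
    conv_lhs => rw [e]
    exact withDensity_smul_measure _ _
  have e3 := congrArg (fun m => m Set.univ) e2
  simp only [measure_univ, Measure.smul_apply, smul_eq_mul, mul_one] at e3
  rw [e2, ← e3, one_smul]

omit [FiniteDimensional ℝ E] [FiniteDimensional ℝ F] in
theorem IsGaussDensity.map {μ : Measure E} {q : E → ℝ} (h : IsGaussDensity μ q) (T : E ≃L[ℝ] F)
    {q' : F → ℝ} (hq : ∀ x, q' (T x) = q x) : IsGaussDensity (μ.map T) q' := by
  have hprob := h.prob
  have hq' : q' = fun y => q (T.symm y) := by
    ext y; rw [← hq, T.apply_symm_apply]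
  obtain ⟨ν, hν, e⟩ := h.density
  refine ⟨Measure.isProbabilityMeasure_map T.continuous.aemeasurable, ?_, ν.map T,
    inferInstance, ?_⟩
  · rw [hq']; exact h.measurable.comp T.symm.continuous.measurable
  · ext s hs
    rw [Measure.map_apply T.continuous.measurable hs, e, withDensity_apply _ hs,
      withDensity_apply _ (T.continuous.measurable hs),
      setLIntegral_map hs _ T.continuous.measurable]
    · simp [hq]
    · rw [hq']
      have := h.measurable.comp T.symm.continuous.measurable
      exact (Real.measurable_exp.comp this.neg).ennreal_ofReal

theorem IsGaussDensity.prod {μ : Measure E} {μ' : Measure F} {q : E → ℝ} {q' : F → ℝ}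
    (h : IsGaussDensity μ q) (h' : IsGaussDensity μ' q') :
    IsGaussDensity (μ.prod μ') (fun p => q p.1 + q' p.2) := by
  have hprob := h.prob
  have hprob' := h'.prob
  obtain ⟨ν, hν, e⟩ := h.density
  obtain ⟨ν', hν', e'⟩ := h'.density
  have m1 : Measurable fun x => ENNReal.ofReal (Real.exp (-q x)) :=
    (Real.measurable_exp.comp h.measurable.neg).ennreal_ofReal
  have m2 : Measurable fun x => ENNReal.ofReal (Real.exp (-q' x)) :=
    (Real.measurable_exp.comp h'.measurable.neg).ennreal_ofReal
  refine ⟨inferInstance, (h.measurable.comp measurable_fst).add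
    (h'.measurable.comp measurable_snd), ν.prod ν', inferInstance, ?_⟩
  rw [e, e', prod_withDensity m1 m2]
  congr 1
  ext p
  rw [neg_add, Real.exp_add, ENNReal.ofReal_mul (Real.exp_nonneg _)]

theorem IsGaussDensity.pi {μ : Measure E} {q : E → ℝ} (h : IsGaussDensity μ q) (m : ℕ) :
    IsGaussDensity (Measure.pi fun _ : Fin m => μ) (fun x => ∑ i, q (x i)) := by
  have hprob := h.prob
  induction m with
  | zero =>
    obtain ⟨ν, hν, -⟩ := h.density
    refine ⟨inferInstance, by simp, Measure.pi fun _ : Fin 0 => ν, inferInstance, ?_⟩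
    rw [Measure.pi_of_empty _ isEmptyElim, Measure.pi_of_empty _ isEmptyElim]
    simp
  | succ m ih =>
    have e := (measurePreserving_piFinSuccAbove (fun _ : Fin (m + 1) => μ) 0).symm.map_eq
    have := (h.prod ih).map (Fin.consEquivL ℝ (fun _ : Fin (m + 1) => E))
      (q' := fun x => ∑ i, q (x i)) (by intro x; simp [Fin.sum_univ_succ])
    have e' : ⇑(MeasurableEquiv.piFinSuccAbove (fun _ : Fin (m + 1) => E) 0).symm
        = ⇑(Fin.consEquivL ℝ (fun _ : Fin (m + 1) => E)) := by
      ext p i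
      simp [MeasurableEquiv.piFinSuccAbove, Fin.insertNthEquiv, Fin.consEquivL]
    rw [← e, e']
    exact this

end General

section Inner

variable {E : Type*} [NormedAddCommGroup E] [InnerProductSpace ℝ E] [MeasurableSpace E]
  [BorelSpace E] [FiniteDimensional ℝ E]

theorem lintegral_exp_neg_mul_sq_norm {b : ℝ} (hb : 0 < b) :
    ∫⁻ x : E, ENNReal.ofReal (Real.exp (-b * ‖x‖ ^ 2)) =
      ENNReal.ofReal ((Real.pi / b) ^ (Module.finrank ℝ E / 2 : ℝ)) := by
  rw [← GaussianFourier.integral_rexp_neg_mul_sq_norm (V := E) hb, ofReal_integral_eq_lintegral_ofReal]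
  · by_contra hcon
    have := GaussianFourier.integral_rexp_neg_mul_sq_norm (V := E) hb
    rw [integral_undef hcon] at this
    have h2 : 0 < (Real.pi / b) ^ (Module.finrank ℝ E / 2 : ℝ) := by positivity
    linarith
  · exact Filter.Eventually.of_forall fun _ => (Real.exp_nonneg _)

theorem isGaussDensity_volume : ∃ c : ℝ≥0∞, c ≠ ∞ ∧ IsGaussDensity
    ((c • (volume : Measure E)).withDensity fun x => ENNReal.ofReal (Real.exp (-‖x‖ ^ 2)))
    (fun x : E => ‖x‖ ^ 2) := by
  have h1 := lintegral_exp_neg_mul_sq_norm (E := E) one_pos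
  have hpos : 0 < (Real.pi / 1) ^ (Module.finrank ℝ E / 2 : ℝ) := by positivity
  set a := (Real.pi / 1) ^ (Module.finrank ℝ E / 2 : ℝ)
  have ha : ENNReal.ofReal a ≠ 0 := by simpa using hpos
  have hc0 : (ENNReal.ofReal a)⁻¹ ≠ 0 := by simp
  have hct : (ENNReal.ofReal a)⁻¹ ≠ ∞ := by simpa using hpos
  refine ⟨(ENNReal.ofReal a)⁻¹, hct, ⟨?_⟩, by fun_prop,
    (ENNReal.ofReal a)⁻¹ • volume, Measure.IsAddHaarMeasure.smul _ hc0 hct, rfl⟩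
  rw [withDensity_smul_measure, Measure.smul_apply, withDensity_apply _ MeasurableSet.univ,
    Measure.restrict_univ]
  simp only [neg_mul, one_mul] at h1
  rw [h1, smul_eq_mul, ENNReal.inv_mul_cancel ha (by simp)]

/-- The orthogonal projection of a Gaussian is Gaussian. -/
theorem IsGaussDensity.map_orthogonalProjectionOnto {μ : Measure E}
    (h : IsGaussDensity μ fun x => ‖x‖ ^ 2) (V : Submodule ℝ E) :
    IsGaussDensity (μ.map V.orthogonalProjectionOnto) fun x => ‖x‖ ^ 2 := by
  obtain ⟨c, -, hV⟩ := isGaussDensity_volume (E := V)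
  obtain ⟨c', -, hV'⟩ := isGaussDensity_volume (E := Vᗮ)
  set γ := (c • (volume : Measure V)).withDensity fun x => ENNReal.ofReal (Real.exp (-‖x‖ ^ 2))
  set γ' := (c' • (volume : Measure Vᗮ)).withDensity
    fun x => ENNReal.ofReal (Real.exp (-‖x‖ ^ 2))
  let T : (V × Vᗮ) ≃L[ℝ] E :=
    (V.prodEquivOfIsCompl Vᗮ V.isCompl_orthogonal).toContinuousLinearEquiv
  have hT : ∀ x, T x = (x.1 : E) + x.2 := fun x => by
    simp [T, Submodule.coe_prodEquivOfIsCompl']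
  have h1 : μ = (γ.prod γ').map T := by
    refine h.unique ((hV.prod hV').map T fun x => ?_)
    rw [hT, pow_two, norm_add_sq_eq_norm_sq_add_norm_sq_real]
    · simp [pow_two]
    · exact Submodule.inner_right_of_mem_orthogonal x.1.2 x.2.2
  have hp := hV.prob
  have hp' := hV'.prob
  have h2 : μ.map V.orthogonalProjectionOnto = γ := by
    rw [h1, Measure.map_map (by fun_prop) (by fun_prop)]
    have : (V.orthogonalProjectionOnto ∘ T) = Prod.fst := by
      funext x
      rw [Function.comp_apply, hT, map_add, Submodule.orthogonalProjectionOnto_mem_subspace_eq_self,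
        (Submodule.orthogonalProjectionOnto_eq_zero_iff).2 x.2.2, add_zero]
    rw [this, Measure.map_fst_prod]
    simp
  rw [h2]
  exact hV

end Inner

theorem isGaussDensity_gaussianReal :
    IsGaussDensity (gaussianReal 0 (1 / 2)) fun x : ℝ => x ^ 2 := by
  refine ⟨inferInstance, by fun_prop, ENNReal.ofReal (√(Real.pi))⁻¹ • volume,
    Measure.IsAddHaarMeasure.smul _ (by simp [Real.pi_pos]) (by simp), ?_⟩
  rw [gaussianReal_of_var_ne_zero _ (by norm_num), withDensity_smul_measure,
    ← withDensity_smul _ (by fun_prop)]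
  congr 1
  ext x
  simp only [gaussianPDF, gaussianPDFReal, Pi.smul_apply, smul_eq_mul]
  rw [← ENNReal.ofReal_mul (by positivity)]
  congr 2
  · rw [show 2 * Real.pi * ((1 / 2 : NNReal) : ℝ) = Real.pi by push_cast; ring]
  · congr 1; simp

theorem isGaussDensity_complexGaussian :
    IsGaussDensity complexGaussian fun z : ℂ => ‖z‖ ^ 2 := by
  have := (isGaussDensity_gaussianReal.prod isGaussDensity_gaussianReal).map
    Complex.equivRealProdCLM.symm (q' := fun z : ℂ => ‖z‖ ^ 2)
    (by intro x; rw [← Complex.normSq_eq_norm_sq]; simp [Complex.normSq_apply, pow_two])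
  exact this

/-- `gaussianMatrix` on the underlying function space. -/
def gaussMat (m n : ℕ) : Measure (Fin m → Fin n → ℂ) :=
  Measure.pi fun _ : Fin m => Measure.pi fun _ : Fin n => complexGaussian

/-- `gaussianBlocks` on the underlying function space. -/
def gaussBlk (m n k : ℕ) : Measure (Fin k → Fin m → Fin n → ℂ) :=
  Measure.pi fun _ : Fin k => gaussMat m n

theorem isGaussDensity_gaussMat (m n : ℕ) :
    IsGaussDensity (gaussMat m n) fun H => ∑ a, ∑ b, ‖H a b‖ ^ 2 :=
  (isGaussDensity_complexGaussian.pi n).pi m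

theorem isGaussDensity_gaussBlk (m n k : ℕ) :
    IsGaussDensity (gaussBlk m n k) fun H => ∑ i, ∑ a, ∑ b, ‖H i a b‖ ^ 2 :=
  (isGaussDensity_gaussMat m n).pi k

section Radial

variable {E : Type*} [NormedAddCommGroup E] [InnerProductSpace ℝ E] [MeasurableSpace E]
  [BorelSpace E] [FiniteDimensional ℝ E]

theorem lintegral_exp_neg_sq_norm_mul_rpow (ν : Measure E) [ν.IsAddHaarMeasure] {d : ℕ}
    (hd : 1 ≤ d) (hE : Module.finrank ℝ E = 2 * d) {s : ℝ} (hs : -(d : ℝ) < s) :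
    ∫⁻ x, ENNReal.ofReal (Real.exp (-‖x‖ ^ 2)) * ENNReal.ofReal (‖x‖ ^ 2) ^ s ∂ν =
      ENNReal.ofReal (d * ν.real (Metric.ball 0 1) * Real.Gamma (d + s)) := by
  have hnt : Nontrivial E := Module.nontrivial_of_finrank_pos (R := ℝ) (by omega)
  let f : ℝ → ℝ := fun r => Real.exp (-r ^ 2) * (r ^ 2) ^ s
  have hrad : ∀ y ∈ Set.Ioi (0 : ℝ), y ^ (Module.finrank ℝ E - 1) • f y =
      y ^ ((2 * d + 2 * s - 1 : ℝ)) * Real.exp (-y ^ (2 : ℝ)) := by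
    intro y hy
    have hy : 0 < y := hy
    simp only [f, smul_eq_mul]
    rw [hE, ← Real.rpow_natCast y (2 * d - 1), ← Real.rpow_natCast y 2, ← Real.rpow_mul hy.le,
      mul_comm (Real.exp _), ← mul_assoc, ← Real.rpow_add hy, Nat.cast_sub (by omega)]
    push_cast
    ring_nf
  have hval : ∫ y in Set.Ioi (0 : ℝ), y ^ (Module.finrank ℝ E - 1) • f y =
      1 / 2 * Real.Gamma (d + s) := by
    rw [setIntegral_congr_fun measurableSet_Ioi hrad,
      integral_rpow_mul_exp_neg_rpow two_pos (by linarith)]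
    congr 2; ring
  have hG : 0 < Real.Gamma (d + s) := Real.Gamma_pos_of_pos (by linarith)
  have hint : Integrable (fun x : E => f ‖x‖) ν := by
    rw [integrable_fun_norm_addHaar]
    by_contra hcon
    rw [integral_undef hcon] at hval
    linarith
  have hne : ∀ᵐ x ∂ν, x ≠ (0 : E) := by
    simp [ae_iff]
  calc _ = ∫⁻ x, ENNReal.ofReal (f ‖x‖) ∂ν := by
        refine lintegral_congr_ae ?_
        filter_upwards [hne] with x hx
        have : 0 < ‖x‖ := norm_pos_iff.2 hx
        rw [ENNReal.ofReal_rpow_of_pos (by positivity), ← ENNReal.ofReal_mul (Real.exp_nonneg _)]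
    _ = ENNReal.ofReal (∫ x, f ‖x‖ ∂ν) := by
        rw [ofReal_integral_eq_lintegral_ofReal hint]
        exact Filter.Eventually.of_forall fun x => by positivity
    _ = _ := by
        rw [integral_fun_norm_addHaar, hval, hE]
        congr 1
        simp only [nsmul_eq_mul, smul_eq_mul]
        push_cast
        ring

/-- The moments of the squared norm of a complex Gaussian vector. -/
theorem IsGaussDensity.lintegral_sq_norm_rpow {μ : Measure E}
    (h : IsGaussDensity μ fun x => ‖x‖ ^ 2) {d : ℕ} (hd : 1 ≤ d)
    (hE : Module.finrank ℝ E = 2 * d) {s : ℝ} (hs : -(d : ℝ) < s) :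
    ∫⁻ x, ENNReal.ofReal (‖x‖ ^ 2) ^ s ∂μ =
      ENNReal.ofReal (Real.Gamma (d + s) / Real.Gamma d) := by
  have hprob := h.prob
  obtain ⟨ν, hν, e⟩ := h.density
  have key : ∀ s : ℝ, -(d : ℝ) < s → ∫⁻ x, ENNReal.ofReal (‖x‖ ^ 2) ^ s ∂μ =
      ENNReal.ofReal (d * ν.real (Metric.ball 0 1) * Real.Gamma (d + s)) := by
    intro s hs
    rw [← lintegral_exp_neg_sq_norm_mul_rpow ν hd hE hs, e,
      lintegral_withDensity_eq_lintegral_mul _ (by fun_prop) (by fun_prop)]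
    rfl
  have hd0 : (0 : ℝ) < d := by exact_mod_cast hd
  have h0 := key 0 (by linarith)
  simp only [ENNReal.rpow_zero, lintegral_one, measure_univ, add_zero] at h0
  have h0 : (d * ν.real (Metric.ball 0 1) * Real.Gamma d) = 1 := by
    have := congrArg ENNReal.toReal h0
    rw [ENNReal.toReal_ofReal] at this
    · simpa using this.symm
    · have := Real.Gamma_pos_of_pos hd0
      positivity
  have hG := Real.Gamma_pos_of_pos hd0
  rw [key s hs]
  congr 1
  rw [eq_div_iff hG.ne']
  linear_combination (Real.Gamma (d + s)) * h0

/-- The exponential moments of the squared norm of a Gaussian vector. -/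
theorem IsGaussDensity.lintegral_exp_mul_sq_norm {μ : Measure E}
    (h : IsGaussDensity μ fun x => ‖x‖ ^ 2) {t : ℝ} (ht : t < 1) :
    ∫⁻ x, ENNReal.ofReal (Real.exp (t * ‖x‖ ^ 2)) ∂μ =
      ENNReal.ofReal ((1 - t) ^ (-(Module.finrank ℝ E / 2 : ℝ))) := by
  obtain ⟨c, hc, hg⟩ := isGaussDensity_volume (E := E)
  have key : ∀ t : ℝ, t < 1 → ∫⁻ x, ENNReal.ofReal (Real.exp (t * ‖x‖ ^ 2)) ∂μ =
      c * ENNReal.ofReal ((Real.pi / (1 - t)) ^ (Module.finrank ℝ E / 2 : ℝ)) := by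
    intro t ht
    rw [h.unique hg, withDensity_smul_measure, lintegral_smul_measure, smul_eq_mul,
      ← lintegral_exp_neg_mul_sq_norm (E := E) (by linarith : 0 < 1 - t),
      lintegral_withDensity_eq_lintegral_mul _ (by fun_prop) (by fun_prop)]
    congr 2
    ext x
    rw [Pi.mul_apply, ← ENNReal.ofReal_mul (Real.exp_nonneg _), ← Real.exp_add]
    ring_nf
  have hprob := h.prob
  have h0 := key 0 one_pos
  simp only [zero_mul, Real.exp_zero, ENNReal.ofReal_one, lintegral_one, measure_univ,
    sub_zero, div_one] at h0
  have h1 : (0 : ℝ) < 1 - t := by linarith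
  rw [key t ht, Real.div_rpow Real.pi_pos.le h1.le, div_eq_mul_inv,
    ENNReal.ofReal_mul (by positivity), ← mul_assoc, ← h0, one_mul, Real.rpow_neg h1.le]

end Radial

/-- Column expansion of a Gram determinant. -/
theorem det_gram_fromCols {m n : Type*} [Fintype m] [Fintype n] [DecidableEq n]
    (r : Matrix m Unit ℂ) (A : Matrix m n ℂ) (v : Matrix n Unit ℂ) (hr : Aᴴ * r = 0) :
    ((Matrix.fromCols (r + A * v) A)ᴴ * Matrix.fromCols (r + A * v) A).det =
      (rᴴ * r) () () * (Aᴴ * A).det := by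
  classical
  have hr' : rᴴ * A = 0 := by
    have := congrArg Matrix.conjTranspose hr
    simpa using this
  let U : Matrix (Unit ⊕ n) (Unit ⊕ n) ℂ := Matrix.fromBlocks 1 0 v 1
  let B : Matrix m (Unit ⊕ n) ℂ := Matrix.fromCols r A
  have hU : Matrix.fromCols (r + A * v) A = B * U := by
    simp [B, U, Matrix.fromCols_mul_fromBlocks]
  have hdU : U.det = 1 := by simp [U]
  have hB : (Bᴴ * B).det = (rᴴ * r) () () * (Aᴴ * A).det := by
    simp only [B]
    rw [Matrix.conjTranspose_fromCols_eq_fromRows_conjTranspose, Matrix.fromRows_mul_fromCols,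
      hr, hr', Matrix.det_fromBlocks_zero₁₂]
    simp
  rw [hU, Matrix.conjTranspose_mul, Matrix.mul_assoc, ← Matrix.mul_assoc Bᴴ,
    Matrix.det_mul, Matrix.det_mul, Matrix.det_conjTranspose, hdU, hB]
  simp

/-- The Gram determinant `det (H† H)`. -/
def gramDet {m n : Type*} [Fintype m] [Fintype n] [DecidableEq n] (H : Matrix m n ℂ) : ℝ :=
  (Hᴴ * H).det.re

open scoped ComplexOrder in
theorem gramDet_nonneg {m n : Type*} [Fintype m] [Fintype n] [DecidableEq n] (H : Matrix m n ℂ) :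
    0 ≤ gramDet H := by
  have := (Matrix.posSemidef_conjTranspose_mul_self H).det_nonneg
  exact (Complex.le_def.1 this).1

open scoped ComplexOrder in
theorem ofReal_gramDet {m n : Type*} [Fintype m] [Fintype n] [DecidableEq n] (H : Matrix m n ℂ) :
    ((gramDet H : ℝ) : ℂ) = (Hᴴ * H).det := by
  have := (Matrix.posSemidef_conjTranspose_mul_self H).det_nonneg
  have h2 := (Complex.le_def.1 this).2
  apply Complex.ext
  · simp [gramDet]
  · simpa using h2

theorem continuous_gramDet (m n : ℕ) :
    Continuous fun H : Fin m → Fin n → ℂ => gramDet (Matrix.of H) := by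
  have h : Continuous fun H : Fin m → Fin n → ℂ => (Matrix.of H : Matrix (Fin m) (Fin n) ℂ) :=
    continuous_id
  exact Complex.continuous_re.comp ((h.matrix_conjTranspose.matrix_mul h).matrix_det)

theorem injective_mulVec_of_gramDet_ne_zero {m n : Type*} [Fintype m] [Fintype n] [DecidableEq n]
    {H : Matrix m n ℂ} (h : gramDet H ≠ 0) : Function.Injective H.mulVec := by
  have hu : IsUnit (Hᴴ * H) := by
    rw [Matrix.isUnit_iff_isUnit_det, ← ofReal_gramDet, isUnit_iff_ne_zero]
    exact_mod_cast h
  intro v w hvw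
  apply Matrix.mulVec_injective_of_isUnit hu
  simp only [← Matrix.mulVec_mulVec]
  rw [hvw]

/-- The matrix with first column `h` and remaining columns those of `H`. -/
def consCol {m n : ℕ} (h : Fin m → ℂ) (H : Fin m → Fin n → ℂ) : Fin m → Fin (n + 1) → ℂ :=
  fun a => Fin.cons (h a) (H a)

/-- Splitting off the first column, as a linear equivalence. -/
def consColL (m n : ℕ) :
    ((Fin m → ℂ) × (Fin m → Fin n → ℂ)) ≃L[ℝ] (Fin m → Fin (n + 1) → ℂ) :=
  LinearEquiv.toContinuousLinearEquiv
    { toFun := fun p => consCol p.1 p.2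
      invFun := fun H => (fun a => H a 0, fun a => Fin.tail (H a))
      map_add' := fun p q => by
        ext a b; refine Fin.cases ?_ (fun b => ?_) b <;> simp [consCol]
      map_smul' := fun c p => by
        ext a b; refine Fin.cases ?_ (fun b => ?_) b <;> simp [consCol]
      left_inv := fun p => by simp [consCol]
      right_inv := fun H => by
        ext a b; refine Fin.cases ?_ (fun b => ?_) b <;> simp [consCol, Fin.tail] }

theorem consColL_apply {m n : ℕ} (p : (Fin m → ℂ) × (Fin m → Fin n → ℂ)) :
    consColL m n p = consCol p.1 p.2 := rfl

theorem gaussMat_succ (m n : ℕ) :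
    gaussMat m (n + 1) =
      ((Measure.pi fun _ : Fin m => complexGaussian).prod (gaussMat m n)).map (consColL m n) := by
  refine (isGaussDensity_gaussMat m (n + 1)).unique
    (((isGaussDensity_complexGaussian.pi m).prod (isGaussDensity_gaussMat m n)).map
      (consColL m n) fun p => ?_)
  rw [consColL_apply]
  simp [consCol, Fin.sum_univ_succ, Finset.sum_add_distrib]

theorem gramDet_consCol {m n : ℕ} (r : Fin m → ℂ) (H : Matrix (Fin m) (Fin n) ℂ) (v : Fin n → ℂ)
    (hr : Hᴴ *ᵥ r = 0) :
    gramDet (Matrix.of (consCol (r + H *ᵥ v) H)) = (∑ a, ‖r a‖ ^ 2) * gramDet H := by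
  let e : Fin (n + 1) ≃ Unit ⊕ Fin n :=
    (finSuccEquiv n).trans ((Equiv.optionEquivSumPUnit (Fin n)).trans (Equiv.sumComm _ _))
  let R : Matrix (Fin m) Unit ℂ := Matrix.replicateCol Unit r
  let v' : Matrix (Fin n) Unit ℂ := Matrix.replicateCol Unit v
  let F : Matrix (Fin m) (Unit ⊕ Fin n) ℂ := Matrix.fromCols (R + H * v') H
  have hC : (Matrix.of (consCol (r + H *ᵥ v) H) : Matrix (Fin m) (Fin (n + 1)) ℂ) =
      F.submatrix id e := by
    ext a b
    refine Fin.cases ?_ (fun b => ?_) b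
    · simp [consCol, F, e, R, v', Matrix.mul_apply, Matrix.mulVec, dotProduct]
    · simp [consCol, F, e]
  have hR : Hᴴ * R = 0 := by
    ext a b
    have := congrFun hr a
    simpa [R, Matrix.mul_apply, Matrix.mulVec, dotProduct] using this
  have h1 := det_gram_fromCols R H v' hR
  have h2 : (Rᴴ * R) () () = ((∑ a, ‖r a‖ ^ 2 : ℝ) : ℂ) := by
    simp [R, Matrix.mul_apply, Complex.conj_mul']
  have h3 : ((F.submatrix id e)ᴴ * F.submatrix id e).det = (Fᴴ * F).det := by
    rw [Matrix.conjTranspose_submatrix, ← Matrix.submatrix_mul _ _ _ _ _ Function.bijective_id,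
      Matrix.det_submatrix_equiv_self]
  rw [gramDet, hC, h3]
  change (Fᴴ * F).det = _ at h1
  rw [h1, h2, ← ofReal_gramDet, ← Complex.ofReal_mul, Complex.ofReal_re]

/-- The part of `γ` orthogonal to the columns of `H` governs the Gram determinant. -/
theorem lintegral_gramDet_consCol {m n : ℕ} (hnm : n < m) (H : Matrix (Fin m) (Fin n) ℂ)
    (hH : gramDet H ≠ 0) {s : ℝ} (hs : -1 < s) :
    ∫⁻ h, ENNReal.ofReal (gramDet (Matrix.of (consCol h H))) ^ s
        ∂(Measure.pi fun _ : Fin m => complexGaussian) =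
      ENNReal.ofReal (Real.Gamma ((m - n : ℝ) + s) / Real.Gamma (m - n : ℝ)) *
        ENNReal.ofReal (gramDet H) ^ s := by
  let E := EuclideanSpace ℂ (Fin m)
  let L : (Fin m → ℂ) ≃L[ℝ] E := (PiLp.continuousLinearEquiv 2 ℝ (fun _ : Fin m => ℂ)).symm
  have hL : IsGaussDensity ((Measure.pi fun _ : Fin m => complexGaussian).map L)
      (fun x : E => ‖x‖ ^ 2) :=
    (isGaussDensity_complexGaussian.pi m).map L fun x => by
      rw [EuclideanSpace.norm_sq_eq]; rfl
  let φ : (Fin n → ℂ) →ₗ[ℝ] E :=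
    L.toLinearEquiv.toLinearMap ∘ₗ (H.mulVecLin.restrictScalars ℝ)
  have hφ : ∀ v, φ v = L (H *ᵥ v) := fun v => rfl
  have hinj : Function.Injective φ := fun v w hvw => by
    rw [hφ, hφ] at hvw
    exact injective_mulVec_of_gramDet_ne_zero hH (L.injective hvw)
  let V : Submodule ℝ E := (LinearMap.range φ)ᗮ
  have hdim : Module.finrank ℝ V = 2 * (m - n) := by
    have h1 := Submodule.finrank_add_finrank_orthogonal (LinearMap.range φ)
    rw [LinearMap.finrank_range_of_inj hinj] at h1
    have h2 : Module.finrank ℝ (Fin n → ℂ) = 2 * n := by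
      simp [Module.finrank_pi_fintype, Complex.finrank_real_complex, mul_comm]
    have h3 : Module.finrank ℝ E = 2 * m := by
      rw [← L.toLinearEquiv.finrank_eq]
      simp [Module.finrank_pi_fintype, Complex.finrank_real_complex, mul_comm]
    rw [h2, h3] at h1
    change 2 * n + Module.finrank ℝ V = 2 * m at h1
    omega
  have hcast : ((m - n : ℕ) : ℝ) = m - n := by rw [Nat.cast_sub hnm.le]
  have hproj := (hL.map_orthogonalProjectionOnto V).lintegral_sq_norm_rpow (d := m - n) (s := s)
    (by omega) hdim (by
      have : ((1 : ℕ) : ℝ) ≤ ((m - n : ℕ) : ℝ) := by exact_mod_cast (by omega : 1 ≤ m - n)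
      push_cast at this
      linarith)
  rw [lintegral_map (by fun_prop) (by fun_prop), lintegral_map (by fun_prop) (by fun_prop),
    hcast] at hproj
  rw [← hproj, ← lintegral_mul_const _ (by fun_prop)]
  refine lintegral_congr fun h => ?_
  rw [← ENNReal.mul_rpow_of_ne_top (by simp) (by simp), ← ENNReal.ofReal_mul (by positivity)]
  congr 2
  set r : V := V.orthogonalProjectionOnto (L h) with hr
  have hmem : L h - r ∈ Vᗮ := Submodule.sub_starProjection_mem_orthogonal (K := V) (L h)
  rw [Submodule.orthogonal_orthogonal] at hmem
  obtain ⟨v, hv⟩ := hmem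
  have hh : h = L.symm r + H *ᵥ v := by
    apply L.injective
    rw [map_add, L.apply_symm_apply, ← hφ, hv]
    abel
  have horth : Hᴴ *ᵥ (L.symm r) = 0 := by
    have hin : ∀ w, inner ℝ (φ w) (r : E) = 0 := fun w =>
      r.2 (φ w) ⟨w, rfl⟩
    have hzero : ∀ w : Fin n → ℂ, (star w ⬝ᵥ (Hᴴ *ᵥ (L.symm r))).re = 0 := fun w => by
      rw [← hin w, Matrix.dotProduct_mulVec, ← Matrix.star_mulVec, hφ, PiLp.inner_apply]
      simp only [dotProduct, Complex.re_sum]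
      refine Finset.sum_congr rfl fun a _ => ?_
      rw [Complex.inner, mul_comm]
      rfl
    have h0 := hzero (Hᴴ *ᵥ (L.symm r))
    set w := Hᴴ *ᵥ (L.symm r)
    have h1 : (star w ⬝ᵥ w).re = ∑ a, ‖w a‖ ^ 2 := by
      simp only [dotProduct, Complex.re_sum, Pi.star_apply]
      refine Finset.sum_congr rfl fun a _ => ?_
      rw [Complex.star_def, Complex.conj_mul', ← Complex.ofReal_pow, Complex.ofReal_re]
    rw [h1, Finset.sum_eq_zero_iff_of_nonneg fun _ _ => by positivity] at h0
    ext a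
    simpa using h0 a (Finset.mem_univ a)
  conv_lhs => rw [hh]
  have hnorm : ‖r‖ ^ 2 = ∑ a, ‖L.symm (r : E) a‖ ^ 2 := by
    change ‖(r : E)‖ ^ 2 = _
    rw [EuclideanSpace.norm_sq_eq]
    rfl
  rw [gramDet_consCol _ _ _ horth, hnorm]

/-- The moments of the Gram determinant of a complex Gaussian matrix. -/
theorem lintegral_gramDet_rpow {m n : ℕ} (hnm : n ≤ m) {s : ℝ} (hs : -1 < s) :
    ∫⁻ H, ENNReal.ofReal (gramDet (Matrix.of H)) ^ s ∂gaussMat m n =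
      ENNReal.ofReal (∏ j ∈ Finset.range n,
        Real.Gamma ((m - j : ℝ) + s) / Real.Gamma (m - j : ℝ)) := by
  have hm := fun n => (continuous_gramDet m n).measurable
  induction n generalizing s with
  | zero =>
    have := (isGaussDensity_gaussMat m 0).prob
    simp [gramDet]
  | succ n ih =>
    have hprob := (isGaussDensity_gaussMat m n).prob
    have hprob' := (isGaussDensity_complexGaussian.pi m).prob
    have hne : ∀ᵐ H ∂gaussMat m n, gramDet (Matrix.of H) ≠ 0 := by
      have h1 := ih (by omega) (s := -(1 / 2)) (by norm_num)
      have h2 := ae_lt_top (μ := gaussMat m n) (((hm n).ennreal_ofReal).pow_const (-(1 / 2) : ℝ))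
        (by rw [h1]; simp)
      filter_upwards [h2] with H hH h0
      rw [h0] at hH
      norm_num at hH
    rw [gaussMat_succ, lintegral_map (((hm (n + 1)).ennreal_ofReal).pow_const s) (by fun_prop),
      lintegral_prod_symm' (fun p => ENNReal.ofReal (gramDet (Matrix.of (consColL m n p))) ^ s)
        ((((hm (n + 1)).ennreal_ofReal).pow_const s).comp (consColL m n).continuous.measurable)]
    calc _ = ∫⁻ H, ENNReal.ofReal (Real.Gamma ((m - n : ℝ) + s) / Real.Gamma (m - n : ℝ)) *
          ENNReal.ofReal (gramDet (Matrix.of H)) ^ s ∂gaussMat m n := by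
          refine lintegral_congr_ae ?_
          filter_upwards [hne] with H hH
          exact lintegral_gramDet_consCol (by omega) (Matrix.of H) hH hs
      _ = _ := by
          rw [lintegral_const_mul _ (((hm n).ennreal_ofReal).pow_const s), ih (by omega) hs,
            Finset.prod_range_succ, mul_comm, ENNReal.ofReal_mul]
          refine Finset.prod_nonneg fun j hj => ?_
          have hj := Finset.mem_range.1 hj
          have : (j : ℝ) + 1 ≤ m := by exact_mod_cast (by omega : j + 1 ≤ m)
          exact div_nonneg (Real.Gamma_nonneg_of_nonneg (by linarith))
            (Real.Gamma_nonneg_of_nonneg (by linarith))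

theorem ae_gramDet_ne_zero {m n : ℕ} (hnm : n ≤ m) :
    ∀ᵐ H ∂gaussMat m n, gramDet (Matrix.of H) ≠ 0 := by
  have h1 := lintegral_gramDet_rpow hnm (s := -(1 / 2)) (by norm_num)
  have h2 := ae_lt_top (μ := gaussMat m n)
    (((continuous_gramDet m n).measurable.ennreal_ofReal).pow_const (-(1 / 2) : ℝ))
    (by rw [h1]; simp)
  filter_upwards [h2] with H hH h0
  rw [h0] at hH
  norm_num at hH

open Filter Topology in
/-- Lower-tail large deviation bound for i.i.d. sums. -/
theorem exists_pi_sum_le_exp {Ω : Type*} [MeasurableSpace Ω] (μ : Measure Ω)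
    [IsProbabilityMeasure μ] {X : Ω → ℝ} (hX : Measurable X)
    (h0 : 0 ∈ interior (integrableExpSet X μ)) {η : ℝ} (hη : 0 < η) :
    ∃ c : ℝ, 0 < c ∧ ∀ k : ℕ, (Measure.pi fun _ : Fin k => μ)
      {ω | ∑ i, X (ω i) ≤ k * (∫ x, X x ∂μ - η)} ≤ ENNReal.ofReal (Real.exp (-c * k)) := by
  set M := ∫ x, X x ∂μ with hM
  let f : ℝ → ℝ := fun t => mgf X μ t * Real.exp (-t * (M - η))
  have hf0 : f 0 = 1 := by simp [f]
  have hderiv : HasDerivAt f η 0 := by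
    have h1 := hasDerivAt_mgf h0
    have h2 : HasDerivAt (fun t : ℝ => Real.exp (-t * (M - η))) (-(M - η)) 0 := by
      have := ((hasDerivAt_id (0 : ℝ)).neg.mul_const (M - η)).exp
      simpa using this
    have h3 : HasDerivAt f _ 0 := h1.mul h2
    refine h3.congr_deriv ?_
    simp [← hM]
  have hslope : ∀ᶠ t in 𝓝[≠] (0 : ℝ), 0 < slope f 0 t :=
    (hasDerivAt_iff_tendsto_slope.1 hderiv).eventually_const_lt hη
  have hleft : ∀ᶠ t in 𝓝[<] (0 : ℝ), 0 < slope f 0 t :=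
    hslope.filter_mono (nhdsWithin_mono _ fun x hx => ne_of_lt hx)
  have hmem : ∀ᶠ t in 𝓝[<] (0 : ℝ), t ∈ integrableExpSet X μ :=
    nhdsWithin_le_nhds (mem_of_superset (isOpen_interior.mem_nhds h0) interior_subset)
  obtain ⟨t, ⟨hs, ht⟩, htneg⟩ := ((hleft.and hmem).and self_mem_nhdsWithin).exists
  have htneg : t < 0 := htneg
  have hft : f t < 1 := by
    rw [slope_def_field, hf0, sub_zero, div_pos_iff] at hs
    rcases hs with h | h <;> linarith [h.1, h.2]
  have hint : Integrable (fun x => Real.exp (t * X x)) μ := ht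
  have hfpos : 0 < f t := mul_pos (mgf_pos hint) (Real.exp_pos _)
  refine ⟨-Real.log (f t), by linarith [Real.log_neg hfpos hft], fun k => ?_⟩
  set ν := Measure.pi fun _ : Fin k => μ
  let Y : Fin k → (Fin k → Ω) → ℝ := fun i ω => X (ω i)
  have hmp : ∀ i : Fin k, MeasurePreserving (Function.eval i) ν μ :=
    fun i => measurePreserving_eval (fun _ : Fin k => μ) i
  have hYm : ∀ i, Measurable (Y i) := fun i => hX.comp (measurable_pi_apply i)
  have hind : iIndepFun Y ν := iIndepFun_pi fun i => hX.aemeasurable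
  have hYmgf : ∀ i, mgf (Y i) ν t = mgf X μ t := fun i => by
    rw [← (hmp i).map_eq, mgf_map (hmp i).measurable.aemeasurable (by fun_prop)]
    rfl
  have hYint : ∀ i, Integrable (fun ω => Real.exp (t * Y i ω)) ν := fun i =>
    (hmp i).integrable_comp_of_integrable hint
  have hb := measure_le_le_exp_mul_mgf (μ := ν) (X := ∑ i, Y i) (t := t) (k * (M - η)) htneg.le
    (hind.integrable_exp_mul_sum hYm fun i _ => hYint i)
  rw [hind.mgf_sum hYm, Finset.prod_congr rfl fun i _ => hYmgf i, Finset.prod_const,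
    Finset.card_univ, Fintype.card_fin] at hb
  have hset : {ω : Fin k → Ω | ∑ i, X (ω i) ≤ k * (M - η)} =
      {ω | (∑ i, Y i) ω ≤ k * (M - η)} := by
    ext ω; simp [Y]
  rw [hset, ← ofReal_measureReal]
  refine ENNReal.ofReal_le_ofReal (hb.trans (le_of_eq ?_))
  rw [neg_neg, mul_comm (Real.log _), Real.exp_nat_mul, Real.exp_log hfpos, mul_pow,
    ← Real.exp_nat_mul, mul_comm]
  congr 2
  ring

section LogGram

variable {m n : ℕ}

theorem measurable_log_gramDet :
    Measurable fun H : Fin m → Fin n → ℂ => Real.log (gramDet (Matrix.of H)) :=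
  Real.measurable_log.comp (continuous_gramDet m n).measurable

theorem lintegral_exp_mul_log_gramDet (hnm : n ≤ m) {s : ℝ} (hs : -1 < s) :
    ∫⁻ H, ENNReal.ofReal (Real.exp (s * Real.log (gramDet (Matrix.of H)))) ∂gaussMat m n =
      ENNReal.ofReal (∏ j ∈ Finset.range n,
        Real.Gamma ((m - j : ℝ) + s) / Real.Gamma (m - j : ℝ)) := by
  rw [← lintegral_gramDet_rpow hnm hs]
  refine lintegral_congr_ae ?_
  filter_upwards [ae_gramDet_ne_zero hnm] with H hH
  have hpos : 0 < gramDet (Matrix.of H) := lt_of_le_of_ne (gramDet_nonneg _) hH.symm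
  rw [ENNReal.ofReal_rpow_of_pos hpos, Real.rpow_def_of_pos hpos, mul_comm]

theorem integrable_exp_mul_log_gramDet (hnm : n ≤ m) {s : ℝ} (hs : -1 < s) :
    Integrable (fun H => Real.exp (s * Real.log (gramDet (Matrix.of H)))) (gaussMat m n) := by
  refine ⟨(Real.measurable_exp.comp (measurable_log_gramDet.const_mul s)).aestronglyMeasurable, ?_⟩
  rw [hasFiniteIntegral_iff_ofReal (Filter.Eventually.of_forall fun _ => (Real.exp_pos _).le),
    lintegral_exp_mul_log_gramDet hnm hs]
  exact ENNReal.ofReal_lt_top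

theorem zero_mem_interior_integrableExpSet_log_gramDet (hnm : n ≤ m) :
    0 ∈ interior (integrableExpSet (fun H => Real.log (gramDet (Matrix.of H))) (gaussMat m n)) := by
  refine mem_interior.2 ⟨Set.Ioi (-1), fun s hs => ?_, isOpen_Ioi, by simp⟩
  exact integrable_exp_mul_log_gramDet hnm hs

theorem mgf_log_gramDet (hnm : n ≤ m) {s : ℝ} (hs : -1 < s) :
    mgf (fun H => Real.log (gramDet (Matrix.of H))) (gaussMat m n) s =
      ∏ j ∈ Finset.range n, Real.Gamma ((m - j : ℝ) + s) / Real.Gamma (m - j : ℝ) := by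
  rw [mgf, integral_eq_lintegral_of_nonneg_ae
    (Filter.Eventually.of_forall fun _ => (Real.exp_pos _).le)
    (Real.measurable_exp.comp (measurable_log_gramDet.const_mul s)).aestronglyMeasurable,
    lintegral_exp_mul_log_gramDet hnm hs, ENNReal.toReal_ofReal]
  refine Finset.prod_nonneg fun j hj => ?_
  have hj := Finset.mem_range.1 hj
  have : (j : ℝ) + 1 ≤ m := by exact_mod_cast (by omega : j + 1 ≤ m)
  exact div_nonneg (Real.Gamma_nonneg_of_nonneg (by linarith))
    (Real.Gamma_nonneg_of_nonneg (by linarith))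

theorem integral_log_gramDet (hnm : n ≤ m) :
    ∫ H, Real.log (gramDet (Matrix.of H)) ∂gaussMat m n =
      ∑ i ∈ Finset.Icc (m - n + 1) m, digamma i := by
  have hprob := (isGaussDensity_gaussMat m n).prob
  have h0 := deriv_cgf_zero (zero_mem_interior_integrableExpSet_log_gramDet hnm)
  rw [probReal_univ, div_one] at h0
  have hpos : ∀ j ∈ Finset.range n, (1 : ℝ) ≤ (m : ℝ) - j := fun j hj => by
    have hj := Finset.mem_range.1 hj
    have : (j : ℝ) + 1 ≤ m := by exact_mod_cast (by omega : j + 1 ≤ m)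
    linarith
  have hcgf : cgf (fun H => Real.log (gramDet (Matrix.of H))) (gaussMat m n) =ᶠ[nhds 0]
      fun s => ∑ j ∈ Finset.range n,
        (Real.log (Real.Gamma ((m - j : ℝ) + s)) - Real.log (Real.Gamma (m - j : ℝ))) := by
    filter_upwards [isOpen_Ioi.mem_nhds (show (0 : ℝ) ∈ Set.Ioi (-1) by simp)] with s hs
    have hs : -1 < s := hs
    have hG : ∀ j ∈ Finset.range n, 0 < Real.Gamma ((m - j : ℝ) + s) := fun j hj =>
      Real.Gamma_pos_of_pos (by linarith [hpos j hj])
    have hG' : ∀ j ∈ Finset.range n, 0 < Real.Gamma (m - j : ℝ) := fun j hj =>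
      Real.Gamma_pos_of_pos (by linarith [hpos j hj])
    rw [cgf, mgf_log_gramDet hnm hs,
      Real.log_prod fun j hj => (div_pos (hG j hj) (hG' j hj)).ne']
    exact Finset.sum_congr rfl fun j hj => Real.log_div (hG j hj).ne' (hG' j hj).ne'
  have hdiff : ∀ j ∈ Finset.range n, DifferentiableAt ℝ
      (fun s => Real.log (Real.Gamma ((m - j : ℝ) + s)) - Real.log (Real.Gamma (m - j : ℝ))) 0 := by
    intro j hj
    have hp := hpos j hj
    have h1 : DifferentiableAt ℝ Real.Gamma ((m - j : ℝ) + 0) :=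
      Real.differentiableAt_Gamma fun q hq => by
        have : (0 : ℝ) ≤ q := q.cast_nonneg
        linarith
    have h2 : DifferentiableAt ℝ (fun s : ℝ => Real.Gamma ((m - j : ℝ) + s)) 0 :=
      DifferentiableAt.comp (g := Real.Gamma) (0 : ℝ) h1 (by fun_prop)
    exact (h2.log (Real.Gamma_pos_of_pos (by linarith)).ne').sub_const _
  rw [hcgf.deriv_eq, deriv_fun_sum hdiff] at h0
  rw [← h0]
  refine Finset.sum_nbij' (fun j => m - j) (fun i => m - i) ?_ ?_ ?_ ?_ ?_
  · intro j hj; have := Finset.mem_range.1 hj; simp only [Finset.mem_Icc]; omega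
  · intro i hi; have := Finset.mem_Icc.1 hi; simp only [Finset.mem_range]; omega
  · intro j hj; have := Finset.mem_range.1 hj; omega
  · intro i hi; have := Finset.mem_Icc.1 hi; omega
  · intro j hj
    have := Finset.mem_range.1 hj
    rw [deriv_sub_const,
      deriv_comp_const_add (fun t => Real.log (Real.Gamma t)) (m - j : ℝ) 0, add_zero, digamma,
      Nat.cast_sub (by omega)]

end LogGram

theorem logDet_ae_eq {n nr : ℕ} (hn : 1 ≤ n) (hnr : n ≤ nr) {P : ℝ} (hP : 0 < P) :
    (fun H : Fin nr → Fin n → ℂ => logDet P (Matrix.of H)) =ᵐ[gaussMat nr n]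
      fun H => (n * Real.log (P / n) + Real.log (gramDet (Matrix.of H))) / Real.log 2 := by
  filter_upwards [ae_gramDet_ne_zero hnr] with H hH
  have hn0 : (0 : ℝ) < n := by exact_mod_cast hn
  rw [logDet, Matrix.det_smul_of_tower, Fintype.card_fin, Complex.smul_re, smul_eq_mul]
  change Real.log ((P / n) ^ n * gramDet (Matrix.of H)) / _ = _
  rw [Real.log_mul (by positivity) hH, Real.log_pow]

theorem integrable_log_gramDet {n nr : ℕ} (hnr : n ≤ nr) :
    Integrable (fun H => Real.log (gramDet (Matrix.of H))) (gaussMat nr n) :=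
  integrable_of_mem_interior_integrableExpSet (zero_mem_interior_integrableExpSet_log_gramDet hnr)

theorem integrable_logDet {n nr : ℕ} (hn : 1 ≤ n) (hnr : n ≤ nr) {P : ℝ} (hP : 0 < P) :
    Integrable (logDet P) (gaussianMatrix nr n) := by
  have hprob := (isGaussDensity_gaussMat nr n).prob
  have h : Integrable (fun H : Fin nr → Fin n → ℂ => logDet P (Matrix.of H)) (gaussMat nr n) :=
    (((integrable_const _).add (integrable_log_gramDet hnr)).div_const _).congr
      (logDet_ae_eq hn hnr hP).symm
  exact h

theorem integral_logDet {n nr : ℕ} (hn : 1 ≤ n) (hnr : n ≤ nr) {P : ℝ} (hP : 0 < P) :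
    ∫ H, logDet P H ∂(gaussianMatrix nr n) =
      (n * Real.log (P / n) + ∑ i ∈ Finset.Icc (nr - n + 1) nr, digamma i) / Real.log 2 := by
  have hprob := (isGaussDensity_gaussMat nr n).prob
  have h := integral_congr_ae (logDet_ae_eq hn hnr hP)
  rw [integral_div, integral_add (integrable_const _) (integrable_log_gramDet hnr),
    integral_log_gramDet hnr] at h
  simp only [integral_const, probReal_univ, one_smul] at h
  exact h

theorem integral_logDet_eq_logb {n nr : ℕ} (hn : 1 ≤ n) (hnr : n ≤ nr) {P : ℝ} (hP : 0 < P) :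
    ∫ H, logDet P H ∂(gaussianMatrix nr n) =
      n * Real.logb 2 (P / n * Real.exp (1 / n *
        ∑ i ∈ Finset.Icc (nr - n + 1) nr, digamma i)) := by
  have hn0 : (0 : ℝ) < n := by exact_mod_cast hn
  rw [integral_logDet hn hnr hP, Real.logb, Real.log_mul (by positivity) (Real.exp_pos _).ne',
    Real.log_exp]
  field_simp

/-- The identification of the space of blocks with a Euclidean space. -/
def blocksE (m n k : ℕ) : Blocks m n k ≃ₗ[ℝ] EuclideanSpace ℂ (Fin k × Fin m × Fin n) where
  toFun X := WithLp.toLp 2 fun p => X p.1 p.2.1 p.2.2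
  invFun x := fun i => Matrix.of fun a b => x (i, a, b)
  map_add' X Y := by ext p; simp
  map_smul' c X := by ext p; simp
  left_inv X := by ext i a b; simp
  right_inv x := by ext p; simp

theorem norm_sq_blocksE {m n k : ℕ} (X : Blocks m n k) : ‖blocksE m n k X‖ ^ 2 = frobSq X := by
  simp [EuclideanSpace.norm_sq_eq, frobSq, blocksE, Fintype.sum_prod_type]

theorem inner_blocksE {m n k : ℕ} (X Y : Blocks m n k) :
    inner ℝ (blocksE m n k X) (blocksE m n k Y) = frobInner X Y := by
  rw [PiLp.inner_apply]
  simp only [Complex.inner, frobInner, blocksE, Fintype.sum_prod_type, Matrix.trace,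
    Matrix.mul_apply, Matrix.diag_apply, Complex.re_sum, Matrix.conjTranspose_apply,
    LinearEquiv.coe_mk, LinearMap.coe_mk, AddHom.coe_mk]
  refine Finset.sum_congr rfl fun i _ => Finset.sum_congr rfl fun a _ =>
    Finset.sum_congr rfl fun b _ => ?_
  simp [Complex.mul_re]
  ring

theorem finrank_blocks (m n k : ℕ) : Module.finrank ℝ (Blocks m n k) = 2 * (m * n) * k := by
  rw [(blocksE m n k).finrank_eq]
  have : (EuclideanSpace ℂ (Fin k × Fin m × Fin n)) ≃ₗ[ℝ] (Fin k × Fin m × Fin n → ℂ) :=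
    WithLp.linearEquiv 2 ℝ _
  rw [this.finrank_eq]
  simp [Module.finrank_pi_fintype, Complex.finrank_real_complex]
  ring

/-- `blocksE` as a continuous linear equivalence on the underlying function space. -/
def blocksT (m n k : ℕ) :
    (Fin k → Fin m → Fin n → ℂ) ≃L[ℝ] EuclideanSpace ℂ (Fin k × Fin m × Fin n) :=
  LinearEquiv.toContinuousLinearEquiv (blocksE m n k : (Fin k → Fin m → Fin n → ℂ) ≃ₗ[ℝ] _)

theorem isGaussDensity_map_blocksT (m n k : ℕ) :
    IsGaussDensity ((gaussBlk m n k).map (blocksT m n k)) fun x => ‖x‖ ^ 2 :=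
  (isGaussDensity_gaussBlk m n k).map _ fun W => norm_sq_blocksE (m := m) W

/-- The blockwise product `(H₁ D₁, …, H_k D_k)`, linear in `D`. -/
def blockMul {m n k : ℕ} (H : Blocks m n k) : Blocks n n k →ₗ[ℝ] Blocks m n k where
  toFun D := fun i => H i * D i
  map_add' D D' := by ext1 i; exact Matrix.mul_add _ _ _
  map_smul' c D := by ext1 i; exact Matrix.mul_smul (H i) c (D i)

theorem blockMul_apply {m n k : ℕ} (H : Blocks m n k) (D : Blocks n n k) (i : Fin k) :
    blockMul H D i = H i * D i := rfl

/-- Chernoff bound for the part of the noise in the column space of the fading. -/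
theorem gaussBlk_noise_le {m n k : ℕ} (H : Blocks m n k) (c : ℝ) {t : ℝ} (ht0 : 0 ≤ t)
    (ht : t < 1) :
    gaussBlk m n k {W | ∃ D : Blocks n n k,
        c < 2 * frobInner (m := m) W (blockMul H D) - frobSq (blockMul H D)} ≤
      ENNReal.ofReal (Real.exp (-(t * c)) * (1 - t) ^ (-((n ^ 2 * k : ℕ) : ℝ))) := by
  let E := EuclideanSpace ℂ (Fin k × Fin m × Fin n)
  let ψ : Blocks n n k →ₗ[ℝ] E := (blocksE m n k).toLinearMap ∘ₗ blockMul H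
  let V : Submodule ℝ E := LinearMap.range ψ
  have hdim : (Module.finrank ℝ V / 2 : ℝ) ≤ ((n ^ 2 * k : ℕ) : ℝ) := by
    have h1 : Module.finrank ℝ V ≤ 2 * (n * n) * k :=
      (LinearMap.finrank_range_le ψ).trans_eq (finrank_blocks n n k)
    have h2 : (Module.finrank ℝ V : ℝ) ≤ ((2 * (n * n) * k : ℕ) : ℝ) := by exact_mod_cast h1
    push_cast at h2 ⊢
    linarith
  have hE := isGaussDensity_map_blocksT m n k
  have hmeas := (blocksT m n k).continuous.measurable
  have hm := (hE.map_orthogonalProjectionOnto V).lintegral_exp_mul_sq_norm ht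
  rw [lintegral_map (by fun_prop) (by fun_prop), lintegral_map (by fun_prop) hmeas] at hm
  set g : (Fin k → Fin m → Fin n → ℂ) → ℝ≥0∞ := fun W =>
    ENNReal.ofReal (Real.exp (t * ‖V.orthogonalProjectionOnto (blocksT m n k W)‖ ^ 2)) with hg
  have hsub : {W : Fin k → Fin m → Fin n → ℂ | ∃ D : Blocks n n k,
      c < 2 * frobInner (m := m) W (blockMul H D) - frobSq (blockMul H D)} ⊆
      {W | ENNReal.ofReal (Real.exp (t * c)) ≤ g W} := by
    rintro W ⟨D, hD⟩
    refine ENNReal.ofReal_le_ofReal (Real.exp_le_exp.2 (mul_le_mul_of_nonneg_left ?_ ht0))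
    refine hD.le.trans ?_
    set w : E := blocksT m n k W
    set z : V := ⟨ψ D, D, rfl⟩ with hz
    have h1 : frobInner (m := m) W (blockMul H D) = inner ℝ (V.orthogonalProjectionOnto w) z :=
      (inner_blocksE (m := m) W (blockMul H D)).symm.trans
        (Submodule.inner_orthogonalProjectionOnto_eq_of_mem_right z w).symm
    have h2 : frobSq (blockMul H D) = ‖z‖ ^ 2 := (norm_sq_blocksE _).symm
    rw [h1, h2]
    have := norm_sub_sq_real (V.orthogonalProjectionOnto w) z
    nlinarith [sq_nonneg ‖V.orthogonalProjectionOnto w - z‖]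
  refine (measure_mono hsub).trans ?_
  have hexp : ENNReal.ofReal (Real.exp (t * c)) ≠ 0 := by simpa using Real.exp_pos _
  refine (meas_ge_le_lintegral_div (by
    have : Measurable fun W : Fin k → Fin m → Fin n → ℂ =>
      V.orthogonalProjectionOnto (blocksT m n k W) :=
        V.orthogonalProjectionOnto.continuous.measurable.comp hmeas
    exact (by fun_prop : Measurable g).aemeasurable) hexp (by simp)).trans ?_
  rw [hm, ← ENNReal.ofReal_div_of_pos (Real.exp_pos _), Real.exp_neg, div_eq_inv_mul]
  refine ENNReal.ofReal_le_ofReal (mul_le_mul_of_nonneg_left ?_ (by positivity))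
  exact Real.rpow_le_rpow_of_exponent_ge (by linarith) (by linarith) (neg_le_neg hdim)

/-- The event that the noise is large in the column space of the fading. -/
def noiseEvent (n nr k : ℕ) (c : ℝ) : Set (Blocks nr n k × Blocks nr n k) :=
  {p | ∃ D : Blocks n n k, c < 2 * frobInner p.2 (blockMul p.1 D) - frobSq (blockMul p.1 D)}

theorem continuous_frobInner_blockMul {n nr k : ℕ} (D : Blocks n n k) :
    Continuous fun p : (Fin k → Fin nr → Fin n → ℂ) × (Fin k → Fin nr → Fin n → ℂ) =>
      2 * frobInner (m := nr) p.2 (blockMul p.1 D) - frobSq (blockMul (m := nr) p.1 D) := by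
  have hmul : Continuous fun p : (Fin k → Fin nr → Fin n → ℂ) × (Fin k → Fin nr → Fin n → ℂ) =>
      (fun i => Matrix.of (p.1 i) * D i : Fin k → Matrix (Fin nr) (Fin n) ℂ) := by
    refine continuous_pi fun i => ?_
    have h : Continuous fun p : (Fin k → Fin nr → Fin n → ℂ) × (Fin k → Fin nr → Fin n → ℂ) =>
        (Matrix.of (p.1 i) : Matrix (Fin nr) (Fin n) ℂ) :=
      (continuous_apply i).comp continuous_fst
    exact h.matrix_mul continuous_const
  have hsnd : Continuous fun p : (Fin k → Fin nr → Fin n → ℂ) × (Fin k → Fin nr → Fin n → ℂ) =>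
      (fun i => Matrix.of (p.2 i) : Fin k → Matrix (Fin nr) (Fin n) ℂ) := continuous_snd
  have h1 : Continuous fun q : Blocks nr n k × Blocks nr n k => frobInner q.1 q.2 := by
    refine Complex.continuous_re.comp (continuous_finsetSum _ fun i _ => ?_)
    exact (((continuous_apply i).comp continuous_fst).matrix_mul
      ((continuous_apply i).comp continuous_snd).matrix_conjTranspose).matrix_trace
  have h2 : Continuous fun q : Blocks nr n k => frobSq q := by
    refine continuous_finsetSum _ fun i _ => continuous_finsetSum _ fun a _ =>
      continuous_finsetSum _ fun b _ => ?_
    exact (((continuous_apply i).matrix_elem a b).norm).pow 2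
  exact (continuous_const.mul (h1.comp (hsnd.prodMk hmul))).sub (h2.comp hmul)

theorem rayleighChannel_noiseEvent_le (n nr k : ℕ) (c : ℝ) {t : ℝ} (ht0 : 0 ≤ t) (ht : t < 1) :
    rayleighChannel n nr k (noiseEvent n nr k c) ≤
      ENNReal.ofReal (Real.exp (-(t * c)) * (1 - t) ^ (-((n ^ 2 * k : ℕ) : ℝ))) := by
  have hprob := (isGaussDensity_gaussBlk nr n k).prob
  let S : Set ((Fin k → Fin nr → Fin n → ℂ) × (Fin k → Fin nr → Fin n → ℂ)) :=
    {p | ∃ D : Blocks n n k,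
      c < 2 * frobInner (m := nr) p.2 (blockMul p.1 D) - frobSq (blockMul (m := nr) p.1 D)}
  have hS : IsOpen S := by
    have : S = ⋃ D : Blocks n n k, {p | c < 2 * frobInner (m := nr) p.2 (blockMul p.1 D) -
        frobSq (blockMul (m := nr) p.1 D)} := by
      ext p; simp [S]
    rw [this]
    exact isOpen_iUnion fun D => isOpen_lt continuous_const (continuous_frobInner_blockMul D)
  change ((gaussBlk nr n k).prod (gaussBlk nr n k)) S ≤ _
  rw [Measure.prod_apply hS.measurableSet]
  have hconst : ∀ C : ℝ≥0∞, ∫⁻ _ : Fin k → Fin nr → Fin n → ℂ, C ∂gaussBlk nr n k = C :=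
    fun C => by simp
  exact (lintegral_mono fun H => gaussBlk_noise_le (m := nr) H c ht0 ht).trans (hconst _).le

theorem rayleighChannel_noiseEvent_le_exp (n nr k : ℕ) {r : ℝ} (hr : 1 < r) :
    rayleighChannel n nr k (noiseEvent n nr k (n ^ 2 * k * r)) ≤
      ENNReal.ofReal (Real.exp (-(n ^ 2 * (r - 1 - Real.log r)) * k)) := by
  have hr0 : 0 < r := by linarith
  have h1 : r⁻¹ < 1 := inv_lt_one_of_one_lt₀ hr
  have h := rayleighChannel_noiseEvent_le n nr k (n ^ 2 * k * r) (t := 1 - r⁻¹) (by linarith)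
    (by linarith [inv_pos.2 hr0])
  refine h.trans (le_of_eq ?_)
  rw [sub_sub_cancel, Real.inv_rpow hr0.le, ← Real.rpow_neg hr0.le, neg_neg,
    Real.rpow_def_of_pos hr0, ← Real.exp_add]
  congr 2
  push_cast
  field_simp
  ring

/-- Averaging over the translates of a lattice: some translate has at least the average number of
points in `B`. -/
theorem exists_translate_ncard_ge {ι E : Type*} [Fintype ι] [NormedAddCommGroup E]
    [InnerProductSpace ℝ E] [FiniteDimensional ℝ E] [MeasurableSpace E] [BorelSpace E]
    (b : Module.Basis ι ℝ E) {B : Set E} (hB : MeasurableSet B) (hbd : Bornology.IsBounded B) :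
    ∃ x : E, {y : E | y ∈ B ∧ y - x ∈ Submodule.span ℤ (Set.range b)}.Finite ∧
      volume B / volume (ZSpan.fundamentalDomain b) ≤
        ({y : E | y ∈ B ∧ y - x ∈ Submodule.span ℤ (Set.range b)}.ncard : ℝ≥0∞) := by
  set Λ := Submodule.span ℤ (Set.range b) with hΛ
  set F := ZSpan.fundamentalDomain b
  have hF : IsAddFundamentalDomain Λ F volume := ZSpan.isAddFundamentalDomain b volume
  have hF0 : volume F ≠ 0 := ZSpan.measure_fundamentalDomain_ne_zero b
  have hinv : VAddInvariantMeasure Λ E volume :=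
    ⟨fun g s _ => measure_preimage_add volume (g : E) s⟩
  let f : E → ℝ≥0∞ := B.indicator 1
  let N : E → ℝ≥0∞ := fun x => ∑' g : Λ, f (g +ᵥ x)
  have hfm : Measurable f := measurable_one.indicator hB
  have hsum : ∫⁻ x in F, N x = volume B := by
    have h := lintegral_tsum (μ := volume.restrict F) (f := fun (g : Λ) x => f (g +ᵥ x))
      fun g => (hfm.comp (measurable_const_vadd g)).aemeasurable
    rw [h, ← hF.lintegral_eq_tsum'' f, lintegral_indicator_one hB]
  obtain ⟨x, -, hx⟩ := exists_setLAverage_le (f := N) hF0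
    (ZSpan.fundamentalDomain_measurableSet b).nullMeasurableSet
    (by rw [hsum]; exact hbd.measure_lt_top.ne)
  have hfin : {y : E | y ∈ B ∧ y - x ∈ Λ}.Finite := by
    have h1 : Bornology.IsBounded ((fun y => y - x) '' B) :=
      (LipschitzWith.id.sub (LipschitzWith.const x)).isBounded_image hbd
    refine ((ZSpan.setFinite_inter b h1).image fun z => z + x).subset ?_
    rintro y ⟨hyB, hyΛ⟩
    exact ⟨y - x, ⟨⟨y, hyB, rfl⟩, hyΛ⟩, by simp⟩
  refine ⟨x, hfin, ?_⟩
  rw [setLAverage_eq, hsum] at hx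
  refine hx.trans (le_of_eq ?_)
  set T : Set Λ := {g | g +ᵥ x ∈ B}
  have h1 : N x = ∑' g : Λ, T.indicator 1 g := rfl
  have h2 : (fun g : Λ => (g : E) + x) '' T = {y : E | y ∈ B ∧ y - x ∈ Λ} := by
    ext y
    constructor
    · rintro ⟨g, hg, rfl⟩
      exact ⟨hg, by simp⟩
    · rintro ⟨hyB, hyΛ⟩
      refine ⟨⟨y - x, hyΛ⟩, ?_, by simp⟩
      change y - x + x ∈ B
      simpa using hyB
  have hinj : Function.Injective fun g : Λ => (g : E) + x := fun g g' h => by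
    simpa using h
  rw [h1, ← tsum_subtype]
  simp only [Pi.one_apply]
  rw [ENNReal.tsum_set_one, ← hinj.encard_image, h2, ← hfin.cast_ncard_eq]
  rfl

/-- The volume of a fundamental domain is the absolute determinant of the coordinates in an
orthonormal basis. -/
theorem volume_fundamentalDomain_eq_sqrt_gram {ι E : Type*} [Fintype ι] [DecidableEq ι]
    [NormedAddCommGroup E] [InnerProductSpace ℝ E] [FiniteDimensional ℝ E] [MeasurableSpace E]
    [BorelSpace E] (b : Module.Basis ι ℝ E) :
    volume (ZSpan.fundamentalDomain b) =
      ENNReal.ofReal √|(Matrix.of fun i j => inner ℝ (b i) (b j)).det| := by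
  have hcard : Fintype.card (Fin (Module.finrank ℝ E)) = Fintype.card ι := by
    rw [Fintype.card_fin, Module.finrank_eq_card_basis b]
  let u : OrthonormalBasis ι ℝ E :=
    (stdOrthonormalBasis ℝ E).reindex (Fintype.equivOfCardEq hcard)
  set M : Matrix ι ι ℝ := u.toBasis.toMatrix b with hM
  have hgram : (Matrix.of fun i j => inner ℝ (b i) (b j)) = Mᵀ * M := by
    ext i j
    rw [Matrix.mul_apply, Matrix.of_apply, ← u.sum_inner_mul_inner]
    refine Finset.sum_congr rfl fun l _ => ?_
    simp [hM, Module.Basis.toMatrix_apply, OrthonormalBasis.repr_apply_apply, real_inner_comm]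
  rw [ZSpan.measure_fundamentalDomain b volume u.toBasis,
    measure_congr (ZSpan.fundamentalDomain_ae_parallelepiped u.toBasis volume),
    OrthonormalBasis.coe_toBasis, u.volume_parallelepiped, mul_one, hgram, Matrix.det_mul,
    Matrix.det_transpose, abs_mul_self, Real.sqrt_mul_self_eq_abs, Module.Basis.det_apply]

namespace FullLattice

variable {n k : ℕ} (L : FullLattice n k)

theorem exists_basis_blocksE (hn : 1 ≤ n) (hk : 1 ≤ k) {α : ℝ} (hα : α ≠ 0) :
    ∃ b : Module.Basis (Fin (2 * n ^ 2 * k)) ℝ (EuclideanSpace ℂ (Fin k × Fin n × Fin n)),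
      ∀ i, b i = blocksE n n k (α • L.basis i) := by
  let e : Blocks n n k ≃ₗ[ℝ] EuclideanSpace ℂ (Fin k × Fin n × Fin n) :=
    (LinearEquiv.smulOfNeZero ℝ (Blocks n n k) α hα).trans (blocksE n n k)
  have hli : LinearIndependent ℝ (e ∘ L.basis) := L.linearIndependent.map' e.toLinearMap e.ker
  have hcard : Fintype.card (Fin (2 * n ^ 2 * k)) =
      Module.finrank ℝ (EuclideanSpace ℂ (Fin k × Fin n × Fin n)) := by
    rw [← (blocksE n n k).finrank_eq, finrank_blocks, Fintype.card_fin, pow_two]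
  have : Nonempty (Fin (2 * n ^ 2 * k)) := ⟨⟨0, by positivity⟩⟩
  refine ⟨basisOfLinearIndependentOfCardEqFinrank hli hcard, fun i => ?_⟩
  rw [coe_basisOfLinearIndependentOfCardEqFinrank]
  rfl

theorem mem_span_iff {α : ℝ}
    {b : Fin (2 * n ^ 2 * k) → EuclideanSpace ℂ (Fin k × Fin n × Fin n)}
    (hb : ∀ i, b i = blocksE n n k (α • L.basis i)) (X : Blocks n n k) :
    blocksE n n k X ∈ Submodule.span ℤ (Set.range b) ↔ ∃ Z ∈ L.points, X = α • Z := by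
  let f : Blocks n n k →ₗ[ℤ] EuclideanSpace ℂ (Fin k × Fin n × Fin n) :=
    ((blocksE n n k).toLinearMap ∘ₗ (LinearMap.lsmul ℝ (Blocks n n k) α)).restrictScalars ℤ
  have hf : ∀ Z, f Z = blocksE n n k (α • Z) := fun Z => rfl
  have hrange : Set.range b = f '' Set.range L.basis := by
    rw [← Set.range_comp]
    congr 1
    ext1 i
    exact hb i
  rw [hrange, ← Submodule.map_span, Submodule.mem_map]
  constructor
  · rintro ⟨Z, hZ, h⟩
    exact ⟨Z, hZ, ((blocksE n n k).injective h).symm⟩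
  · rintro ⟨Z, hZ, rfl⟩
    exact ⟨Z, hZ, rfl⟩

theorem vol_pos (hn : 1 ≤ n) (hk : 1 ≤ k) : 0 < L.vol := by
  obtain ⟨b, hb⟩ := L.exists_basis_blocksE hn hk one_ne_zero
  have h := volume_fundamentalDomain_eq_sqrt_gram b
  have h0 : volume (ZSpan.fundamentalDomain b) ≠ 0 := ZSpan.measure_fundamentalDomain_ne_zero b
  simp only [hb, one_smul, inner_blocksE] at h
  rw [h] at h0
  simpa [vol] using h0

theorem volume_fundamentalDomain {α : ℝ} (hα : 0 < α)
    {b : Module.Basis (Fin (2 * n ^ 2 * k)) ℝ (EuclideanSpace ℂ (Fin k × Fin n × Fin n))}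
    (hb : ∀ i, b i = blocksE n n k (α • L.basis i)) :
    volume (ZSpan.fundamentalDomain b) = ENNReal.ofReal (α ^ (2 * n ^ 2 * k) * L.vol) := by
  rw [volume_fundamentalDomain_eq_sqrt_gram b]
  have h : (Matrix.of fun i j => inner ℝ (b i) (b j)) =
      (α ^ 2) • (Matrix.of fun i j => frobInner (L.basis i) (L.basis j)) := by
    ext i j
    simp only [hb, map_smul, inner_smul_left, inner_smul_right, inner_blocksE]
    simp
    ring
  rw [h, Matrix.det_smul, Fintype.card_fin, abs_mul, abs_of_pos (by positivity),
    Real.sqrt_mul (by positivity), ← pow_mul, mul_comm 2 (2 * n ^ 2 * k), pow_mul α,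
    Real.sqrt_sq (by positivity), vol]

end FullLattice

theorem ballConst_pos {n : ℕ} (k : ℕ) (hn : 1 ≤ n) (hk : 1 ≤ k) : 0 < ballConst n k := by
  have : 0 < Real.pi * n * k := by
    have h1 : (0 : ℝ) < n := by exact_mod_cast hn
    have h2 : (0 : ℝ) < k := by exact_mod_cast hk
    have := Real.pi_pos
    positivity
  unfold ballConst
  positivity

namespace FullLattice

variable {n k : ℕ} (L : FullLattice n k)

theorem scale_pos (hn : 1 ≤ n) (hk : 1 ≤ k) {P : ℝ} (hP : 0 < P) (R : ℝ) : 0 < L.scale P R := by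
  have := ballConst_pos k hn hk
  have := L.vol_pos hn hk
  exact Real.sqrt_pos.2 (by positivity)

theorem scale_sq (hn : 1 ≤ n) (hk : 1 ≤ k) {P : ℝ} (hP : 0 < P) (R : ℝ) :
    L.scale P R ^ 2 = ballConst n k ^ (1 / ((n : ℝ) ^ 2 * k)) * P /
      ((2 : ℝ) ^ (R / n) * L.vol ^ (1 / ((n : ℝ) ^ 2 * k))) := by
  have := ballConst_pos k hn hk
  have := L.vol_pos hn hk
  exact Real.sq_sqrt (by positivity)

theorem scale_pow (hn : 1 ≤ n) (hk : 1 ≤ k) {P : ℝ} (hP : 0 < P) (R : ℝ) :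
    L.scale P R ^ (2 * n ^ 2 * k) * L.vol * (2 : ℝ) ^ (R * n * k) =
      ballConst n k * P ^ (n ^ 2 * k) := by
  have hb := ballConst_pos k hn hk
  have hv := L.vol_pos hn hk
  have hn0 : (0 : ℝ) < n := by exact_mod_cast hn
  have hk0 : (0 : ℝ) < k := by exact_mod_cast hk
  have hroot : ∀ x : ℝ, 0 < x → (x ^ (1 / ((n : ℝ) ^ 2 * k))) ^ (n ^ 2 * k) = x := fun x hx => by
    rw [← Real.rpow_natCast, ← Real.rpow_mul hx.le]
    push_cast
    rw [one_div, inv_mul_cancel₀ (by positivity), Real.rpow_one]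
  have h2 : ((2 : ℝ) ^ (R / n)) ^ (n ^ 2 * k) = (2 : ℝ) ^ (R * n * k) := by
    rw [← Real.rpow_natCast, ← Real.rpow_mul two_pos.le]
    congr 1
    push_cast
    field_simp
  rw [mul_assoc 2, pow_mul, L.scale_sq hn hk hP, div_pow, mul_pow, mul_pow, hroot _ hb,
    hroot _ hv, h2]
  field_simp

theorem mem_coset_iff {P R : ℝ} {shift : Blocks n n k}
    {b : Fin (2 * n ^ 2 * k) → EuclideanSpace ℂ (Fin k × Fin n × Fin n)}
    (hb : ∀ i, b i = blocksE n n k (L.scale P R • L.basis i)) (X : Blocks n n k) :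
    X ∈ L.coset P R shift ↔
      blocksE n n k X - blocksE n n k shift ∈ Submodule.span ℤ (Set.range b) := by
  rw [← map_sub, L.mem_span_iff hb]
  constructor
  · rintro ⟨Z, hZ, rfl⟩
    exact ⟨Z, hZ, by abel⟩
  · rintro ⟨Z, hZ, h⟩
    exact ⟨Z, hZ, by rw [← h]; abel⟩

/-- A shifted lattice has finitely many points in a bounded set. -/
theorem coset_inter_finite (hn : 1 ≤ n) (hk : 1 ≤ k) {P : ℝ} (hP : 0 < P) (R : ℝ)
    (shift : Blocks n n k) {r : ℝ} {s : Set (Blocks n n k)}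
    (hs : ∀ X ∈ s, ‖blocksE n n k X‖ ≤ r) : (s ∩ L.coset P R shift).Finite := by
  obtain ⟨b, hb⟩ := L.exists_basis_blocksE hn hk (L.scale_pos hn hk hP R).ne'
  let E := EuclideanSpace ℂ (Fin k × Fin n × Fin n)
  let f : Blocks n n k → E := fun X => blocksE n n k X - blocksE n n k shift
  have hf : Function.Injective f := fun X Y h =>
    (blocksE n n k).injective (sub_left_injective h)
  have hbd : Bornology.IsBounded (Metric.closedBall (0 : E) (r + ‖blocksE n n k shift‖)) :=
    Metric.isBounded_closedBall
  refine Set.Finite.of_finite_image ((ZSpan.setFinite_inter b hbd).subset ?_) hf.injOn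
  rintro _ ⟨X, ⟨hXs, hXc⟩, rfl⟩
  refine ⟨?_, (L.mem_coset_iff hb X).1 hXc⟩
  rw [mem_closedBall_zero_iff]
  exact (norm_sub_le _ _).trans (by gcongr; exact hs X hXs)

/-- Some shift gives a code of the required rate. -/
theorem exists_rateAtLeast (hn : 1 ≤ n) (hk : 1 ≤ k) {P : ℝ} (hP : 0 < P) (R : ℝ) :
    ∃ shift : Blocks n n k, RateAtLeast R (L.code P R shift) := by
  let E := EuclideanSpace ℂ (Fin k × Fin n × Fin n)
  have hα := L.scale_pos hn hk hP R
  obtain ⟨b, hb⟩ := L.exists_basis_blocksE hn hk hα.ne'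
  have hn0 : (0 : ℝ) < n := by exact_mod_cast hn
  have hk0 : (0 : ℝ) < k := by exact_mod_cast hk
  have hPkn : 0 < P * k * n := by positivity
  have hdim : Module.finrank ℝ E = 2 * (n ^ 2 * k) := by
    rw [← (blocksE n n k).finrank_eq, finrank_blocks]; ring
  have hnt : Nontrivial E := Module.nontrivial_of_finrank_pos (R := ℝ) (by
    rw [hdim]; positivity)
  set B : Set E := Metric.closedBall 0 √(P * k * n) with hB
  obtain ⟨x, hfin, hx⟩ := exists_translate_ncard_ge b (B := B) measurableSet_closedBall
    Metric.isBounded_closedBall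
  have hballC := ballConst_pos k hn hk
  have hvol := L.vol_pos hn hk
  have hvolB : volume B = ENNReal.ofReal (ballConst n k * P ^ (n ^ 2 * k)) := by
    rw [hB, InnerProductSpace.volume_closedBall_of_dim_even hdim, hdim,
      ← ENNReal.ofReal_pow (by positivity), ← ENNReal.ofReal_mul (by positivity), pow_mul,
      Real.sq_sqrt hPkn.le, ballConst]
    congr 1
    rw [mul_pow, mul_pow, mul_pow, mul_pow]
    ring
  rw [hvolB, L.volume_fundamentalDomain hα hb, ← L.scale_pow hn hk hP R,
    ← ENNReal.ofReal_div_of_pos (by positivity), mul_div_cancel_left₀ _ (by positivity)] at hx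
  have hcode : blocksE n n k '' L.code P R ((blocksE n n k).symm x) =
      {y : E | y ∈ B ∧ y - x ∈ Submodule.span ℤ (Set.range b)} := by
    ext y
    constructor
    · rintro ⟨X, ⟨hX, hXc⟩, rfl⟩
      refine ⟨?_, ?_⟩
      · rw [hB, mem_closedBall_zero_iff, ← Real.sqrt_sq (norm_nonneg _), norm_sq_blocksE]
        exact hX
      · have := (L.mem_coset_iff hb X).1 hXc
        rwa [LinearEquiv.apply_symm_apply] at this
    · rintro ⟨hyB, hyΛ⟩
      refine ⟨(blocksE n n k).symm y, ⟨?_, ?_⟩, by simp⟩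
      · rw [hB, mem_closedBall_zero_iff] at hyB
        change √(frobSq _) ≤ _
        rw [← norm_sq_blocksE, Real.sqrt_sq (norm_nonneg _), LinearEquiv.apply_symm_apply]
        exact hyB
      · rw [L.mem_coset_iff hb]
        simpa using hyΛ
  rw [← hcode] at hfin hx
  refine ⟨(blocksE n n k).symm x, Set.Finite.of_finite_image hfin
    (blocksE n n k).injective.injOn, ?_⟩
  rw [Set.ncard_image_of_injective _ (blocksE n n k).injective] at hx
  rw [← ENNReal.ofReal_natCast] at hx
  exact (ENNReal.ofReal_le_ofReal_iff (Nat.cast_nonneg _)).1 hx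

end FullLattice

theorem powerConstraint_code {n k : ℕ} (hn : 1 ≤ n) (hk : 1 ≤ k) {P : ℝ} (hP : 0 < P) (R : ℝ)
    (L : FullLattice n k) (shift : Blocks n n k) : PowerConstraint P (L.code P R shift) := by
  rintro X ⟨hX, -⟩
  have hn0 : (0 : ℝ) < n := by exact_mod_cast hn
  have hk0 : (0 : ℝ) < k := by exact_mod_cast hk
  have h : frobSq X ≤ P * k * n := by
    have hX : √(frobSq X) ≤ √(P * k * n) := hX
    exact (Real.sqrt_le_sqrt_iff (by positivity)).1 hX
  rw [one_div, inv_mul_le_iff₀ (by positivity)]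
  linarith

open scoped ComplexOrder in
/-- The arithmetic-geometric mean inequality for the eigenvalues of Gram matrices. -/
theorem amgm_gramDet {m n k : ℕ} (hn : 1 ≤ n) (hk : 1 ≤ k) (A : Blocks m n k) :
    (n * k : ℝ) * (∏ i, gramDet (A i)) ^ (1 / (n * k : ℝ)) ≤ frobSq A := by
  have hn0 : (0 : ℝ) < n := by exact_mod_cast hn
  have hk0 : (0 : ℝ) < k := by exact_mod_cast hk
  have hpsd := fun i => Matrix.posSemidef_conjTranspose_mul_self (A i)
  let ev : Fin k → Fin n → ℝ := fun i => (hpsd i).1.eigenvalues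
  have hev : ∀ i j, 0 ≤ ev i j := fun i j => (hpsd i).eigenvalues_nonneg j
  have hdet : ∀ i, gramDet (A i) = ∏ j, ev i j := fun i => by
    have h : (gramDet (A i) : ℂ) = ((∏ j, ev i j : ℝ) : ℂ) := by
      rw [ofReal_gramDet, (hpsd i).1.det_eq_prod_eigenvalues]
      push_cast
      rfl
    exact_mod_cast h
  have htr : ∀ i, ∑ a, ∑ b, ‖A i a b‖ ^ 2 = ∑ j, ev i j := fun i => by
    have h : ((∑ a, ∑ b, ‖A i a b‖ ^ 2 : ℝ) : ℂ) = ((∑ j, ev i j : ℝ) : ℂ) := by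
      have h1 := (hpsd i).1.trace_eq_sum_eigenvalues
      push_cast
      change _ = ∑ j, (((hpsd i).1.eigenvalues j : ℝ) : ℂ)
      rw [Finset.sum_comm]
      refine Eq.trans ?_ h1
      simp [Matrix.trace, Matrix.mul_apply, Complex.conj_mul']
    exact_mod_cast h
  have hcard : ∑ _p : Fin k × Fin n, (1 : ℝ) = n * k := by
    simp [mul_comm]
  have key := Real.geom_mean_le_arith_mean (Finset.univ : Finset (Fin k × Fin n)) (fun _ => 1)
    (fun p => ev p.1 p.2) (fun _ _ => zero_le_one) (by rw [hcard]; positivity)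
    (fun p _ => hev p.1 p.2)
  simp only [Real.rpow_one, one_mul, hcard, Fintype.sum_prod_type, Fintype.prod_prod_type] at key
  rw [le_div_iff₀ (by positivity)] at key
  simp only [frobSq, hdet, htr, one_div]
  linarith

theorem gramDet_mul {m n : ℕ} (H : Matrix (Fin m) (Fin n) ℂ) (D : Matrix (Fin n) (Fin n) ℂ) :
    gramDet (H * D) = gramDet H * ‖D.det‖ ^ 2 := by
  have h : (gramDet (H * D) : ℂ) = ((gramDet H * ‖D.det‖ ^ 2 : ℝ) : ℂ) := by
    rw [ofReal_gramDet, Matrix.conjTranspose_mul, Matrix.mul_assoc, ← Matrix.mul_assoc Hᴴ,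
      Matrix.det_mul, Matrix.det_mul, Matrix.det_conjTranspose, Complex.ofReal_mul, ofReal_gramDet,
      Complex.ofReal_pow, ← Complex.conj_mul', Complex.star_def]
    ring
  exact_mod_cast h

theorem FullLattice.one_le_norm_pdet {n k : ℕ} {L : FullLattice n k} (hL : L.mindet = 1)
    {Z : Blocks n n k} (hZ : Z ∈ L.points) (hZ0 : Z ≠ 0) : 1 ≤ ‖pdet Z‖ := by
  rw [← hL]
  refine csInf_le ⟨0, ?_⟩ ⟨Z, hZ, hZ0, rfl⟩
  rintro t ⟨X, -, -, rfl⟩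
  exact norm_nonneg _

theorem frobSq_smul {m n k : ℕ} (c : ℝ) (X : Blocks m n k) : frobSq (c • X) = c ^ 2 * frobSq X := by
  rw [← norm_sq_blocksE, ← norm_sq_blocksE, map_smul, norm_smul, mul_pow, Real.norm_eq_abs, sq_abs]

theorem frobSq_sub {m n k : ℕ} (X Y : Blocks m n k) :
    frobSq (X - Y) = frobSq X - 2 * frobInner X Y + frobSq Y := by
  rw [← norm_sq_blocksE, ← norm_sq_blocksE, ← norm_sq_blocksE, ← inner_blocksE, map_sub,
    norm_sub_sq_real]

theorem frobInner_smul_right {m n k : ℕ} (c : ℝ) (X Y : Blocks m n k) :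
    frobInner X (c • Y) = c * frobInner X Y := by
  rw [← inner_blocksE, ← inner_blocksE, map_smul, real_inner_smul_right]

/-- The minimum squared distance of the faded lattice. -/
theorem frobSq_blockMul_ge {n nr k : ℕ} (hn : 1 ≤ n) (hk : 1 ≤ k) {L : FullLattice n k}
    (hL : L.mindet = 1) (H : Blocks nr n k) {Z : Blocks n n k} (hZ : Z ∈ L.points) (hZ0 : Z ≠ 0) :
    (n * k : ℝ) * (∏ i, gramDet (H i)) ^ (1 / (n * k : ℝ)) ≤ frobSq (blockMul H Z) := by
  refine le_trans ?_ (amgm_gramDet hn hk _)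
  have h1 := L.one_le_norm_pdet hL hZ hZ0
  have h0 : 0 ≤ ∏ i, gramDet (H i) := Finset.prod_nonneg fun i _ => gramDet_nonneg _
  have h2 : ∏ i, gramDet (blockMul H Z i) = (∏ i, gramDet (H i)) * ‖pdet Z‖ ^ 2 := by
    simp only [blockMul_apply, gramDet_mul, Finset.prod_mul_distrib, Finset.prod_pow, pdet, norm_prod]
  rw [h2]
  gcongr
  exact le_mul_of_one_le_right h0 (one_le_pow₀ h1)

theorem distSq_received {n nr k : ℕ} (H : Blocks nr n k) (X X' : Blocks n n k) (W : Blocks nr n k) :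
    distSq H (received H X W) X' = frobSq (W - blockMul H (X' - X)) := by
  unfold distSq received
  congr 1
  ext1 i
  rw [Pi.sub_apply, blockMul_apply, Pi.sub_apply, Matrix.mul_sub]
  abel

theorem likelihood_eq {n nr k : ℕ} (H Y : Blocks nr n k) (X : Blocks n n k) :
    likelihood H Y X =
      (∏ _i : Fin k, ∏ _a : Fin nr, ∏ _b : Fin n, (1 / Real.pi)) * Real.exp (-distSq H Y X) := by
  simp only [likelihood, distSq, frobSq, Finset.prod_mul_distrib, ← Real.exp_sum,
    ← Finset.sum_neg_distrib]
  rfl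

theorem distSq_le_of_likelihood_le {n nr k : ℕ} {H Y : Blocks nr n k} {X X' : Blocks n n k}
    (h : likelihood H Y X ≤ likelihood H Y X') : distSq H Y X' ≤ distSq H Y X := by
  rw [likelihood_eq, likelihood_eq] at h
  have hpos : 0 < ∏ _i : Fin k, ∏ _a : Fin nr, ∏ _b : Fin n, (1 / Real.pi) :=
    Finset.prod_pos fun _ _ => Finset.prod_pos fun _ _ => Finset.prod_pos fun _ _ =>
      one_div_pos.2 Real.pi_pos
  have := Real.exp_le_exp.1 (le_of_mul_le_mul_left h hpos)
  linarith

/-- The closest point search succeeds when no fading matrix is rank deficient. -/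
theorem exists_closest_point {n nr k : ℕ} (hn : 1 ≤ n) (hk : 1 ≤ k) {P : ℝ} (hP : 0 < P) (R : ℝ)
    (L : FullLattice n k) (shift : Blocks n n k) (H Y : Blocks nr n k)
    (hH : ∀ i, gramDet (H i) ≠ 0) :
    ∃ X ∈ L.coset P R shift, ∀ X' ∈ L.coset P R shift, distSq H Y X ≤ distSq H Y X' := by
  let T := (blocksE nr n k).toLinearMap ∘ₗ blockMul H ∘ₗ (blocksE n n k).symm.toLinearMap
  have hker : LinearMap.ker T = ⊥ := by
    refine LinearMap.ker_eq_bot.2 ?_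
    refine (blocksE nr n k).injective.comp (Function.Injective.comp (g := blockMul H) ?_
      (blocksE n n k).symm.injective)
    intro D D' h
    ext i a b
    have h1 : H i * D i = H i * D' i := congrFun h i
    have h2 : (H i) *ᵥ (fun a => D i a b) = (H i) *ᵥ (fun a => D' i a b) := by
      ext c
      exact congrFun (congrFun h1 c) b
    exact congrFun (injective_mulVec_of_gramDet_ne_zero (hH i) h2) a
  obtain ⟨C, -, hC⟩ := T.exists_antilipschitzWith hker
  have hbound : ∀ X, ‖blocksE n n k X‖ ≤ C * (√(distSq H Y X) + ‖blocksE nr n k Y‖) := fun X => by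
    have h1 := hC.le_mul_dist (blocksE n n k X) 0
    rw [map_zero, dist_zero_right, dist_zero_right] at h1
    refine h1.trans (mul_le_mul_of_nonneg_left ?_ C.2)
    have h2 : T (blocksE n n k X) = blocksE nr n k (blockMul H X) := by simp [T]
    have h3 : √(distSq H Y X) = ‖blocksE nr n k Y - blocksE nr n k (blockMul H X)‖ := by
      rw [← map_sub, ← Real.sqrt_sq (norm_nonneg (blocksE nr n k (Y - _))), norm_sq_blocksE]
      rfl
    rw [h2, h3, norm_sub_rev]
    have := norm_sub_norm_le (blocksE nr n k (blockMul H X)) (blocksE nr n k Y)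
    linarith
  have hmem : shift ∈ L.coset P R shift := ⟨0, L.points.zero_mem, by simp⟩
  have hfin := L.coset_inter_finite hn hk hP R shift
    (s := {X | distSq H Y X ≤ distSq H Y shift})
    (r := C * (√(distSq H Y shift) + ‖blocksE nr n k Y‖)) fun X hX => by
      have hX : distSq H Y X ≤ distSq H Y shift := hX
      refine (hbound X).trans ?_
      gcongr
  obtain ⟨X, ⟨hX1, hX2⟩, hX⟩ := Set.exists_min_image _ (distSq H Y) hfin ⟨shift, le_refl (distSq H Y shift), hmem⟩
  refine ⟨X, hX2, fun X' hX' => ?_⟩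
  rcases le_total (distSq H Y X') (distSq H Y shift) with h | h
  · exact hX X' ⟨h, hX'⟩
  · exact le_trans hX1 h

/-- The event that the fading is poor. -/
def fadingEvent (n nr k : ℕ) (θ : ℝ) : Set (Blocks nr n k × Blocks nr n k) :=
  {p | ∏ i, gramDet (p.1 i) ≤ θ}

theorem decoding_error_subset {n nr k : ℕ} (hn : 1 ≤ n) (hk : 1 ≤ k) {P : ℝ} (hP : 0 < P) {R : ℝ}
    {L : FullLattice n k} (hL : L.mindet = 1) {shift : Blocks n n k} {dec : Decoder n nr k}
    (hdec : IsMLDecoder (L.code P R shift) dec ∨ IsNaiveDecoder (L.coset P R shift) dec)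
    {θ c : ℝ} (hθ : 0 ≤ θ)
    (hc : 4 * c ≤ (n * k : ℝ) * θ ^ (1 / (n * k : ℝ)) * L.scale P R ^ 2)
    {X : Blocks n n k} (hX : X ∈ L.code P R shift) :
    {p : Blocks nr n k × Blocks nr n k | dec p.1 (received p.1 X p.2) ≠ X} ⊆
      noiseEvent n nr k c ∪ fadingEvent n nr k θ := by
  rintro ⟨H, W⟩ hne
  have hne : dec H (received H X W) ≠ X := hne
  by_cases hfade : ∏ i, gramDet (H i) ≤ θ
  · exact Or.inr hfade
  left
  have hfade : θ < ∏ i, gramDet (H i) := not_le.1 hfade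
  have hα := L.scale_pos hn hk hP R
  have hn0 : (0 : ℝ) < n := by exact_mod_cast hn
  have hk0 : (0 : ℝ) < k := by exact_mod_cast hk
  have hH : ∀ i, gramDet (H i) ≠ 0 := fun i hi => by
    have := Finset.prod_eq_zero (f := fun i => gramDet (H i)) (Finset.mem_univ i) hi
    linarith
  set Y := received H X W with hY
  set X' := dec H Y with hX'
  have hwrong : X' ∈ L.coset P R shift ∧ distSq H Y X' ≤ distSq H Y X := by
    rcases hdec with hdec | hdec
    · obtain ⟨h1, h2⟩ := hdec H Y
      exact ⟨h1.2, distSq_le_of_likelihood_le (h2 X hX)⟩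
    · obtain ⟨h1, h2⟩ := hdec H Y (exists_closest_point hn hk hP R L shift H Y hH)
      exact ⟨h1, h2 X hX.2⟩
  obtain ⟨⟨Z', hZ', hXZ'⟩, hdist⟩ := hwrong
  obtain ⟨Z, hZ, hXZ⟩ := hX.2
  have hD : X' - X = L.scale P R • (Z' - Z) := by
    rw [hXZ', hXZ, smul_sub]; abel
  have hZZ : Z' - Z ≠ 0 := fun h => by
    rw [h, smul_zero, sub_eq_zero] at hD
    exact hne hD
  have hfar := frobSq_blockMul_ge hn hk hL H (L.points.sub_mem hZ' hZ) hZZ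
  rw [hY, distSq_received, distSq_received, sub_self, map_zero, sub_zero, frobSq_sub, hD,
    map_smul] at hdist
  set G := L.scale P R • blockMul H (Z' - Z) with hG
  have hGsq : frobSq G = L.scale P R ^ 2 * frobSq (blockMul H (Z' - Z)) := frobSq_smul _ _
  have hbig : 4 * c < frobSq G := by
    refine hc.trans_lt ?_
    rw [hGsq, mul_comm]
    refine mul_lt_mul_of_pos_left (lt_of_lt_of_le ?_ hfar) (by positivity)
    exact mul_lt_mul_of_pos_left (Real.rpow_lt_rpow hθ hfade (by positivity)) (by positivity)
  refine ⟨(1 / 2 : ℝ) • (L.scale P R • (Z' - Z)), ?_⟩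
  rw [map_smul, map_smul, frobInner_smul_right, frobSq_smul]
  change c < 2 * (1 / 2 * frobInner W G) - (1 / 2) ^ 2 * frobSq G
  linarith

theorem errorProb_le {n nr k : ℕ} (hn : 1 ≤ n) (hk : 1 ≤ k) {P : ℝ} (hP : 0 < P) {R : ℝ}
    {L : FullLattice n k} (hL : L.mindet = 1) {shift : Blocks n n k} {dec : Decoder n nr k}
    (hdec : IsMLDecoder (L.code P R shift) dec ∨ IsNaiveDecoder (L.coset P R shift) dec)
    {θ c : ℝ} (hθ : 0 ≤ θ)
    (hc : 4 * c ≤ (n * k : ℝ) * θ ^ (1 / (n * k : ℝ)) * L.scale P R ^ 2) :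
    errorProb (L.code P R shift) dec ≤
      rayleighChannel n nr k (noiseEvent n nr k c) +
        rayleighChannel n nr k (fadingEvent n nr k θ) :=
  iSup₂_le fun _ hX => (measure_mono (decoding_error_subset hn hk hP hL hdec hθ hc hX)).trans
    (measure_union_le _ _)

theorem errorProb_le_one {n nr k : ℕ} (C : Set (Blocks n n k)) (dec : Decoder n nr k) :
    errorProb C dec ≤ 1 := by
  have hprob : IsProbabilityMeasure (gaussianBlocks nr n k) := (isGaussDensity_gaussBlk nr n k).prob
  have : IsProbabilityMeasure (rayleighChannel n nr k) := by
    unfold rayleighChannel; infer_instance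
  exact iSup₂_le fun _ _ => prob_le_one

/-- Poor fading is exponentially unlikely. -/
theorem exists_fadingEvent_le_exp {n nr : ℕ} (hnr : n ≤ nr) {η : ℝ} (hη : 0 < η) :
    ∃ c : ℝ, 0 < c ∧ ∀ k : ℕ, rayleighChannel n nr k (fadingEvent n nr k
      (Real.exp (k * (∑ i ∈ Finset.Icc (nr - n + 1) nr, digamma i - η)))) ≤
        ENNReal.ofReal (Real.exp (-c * k)) := by
  have hprob := (isGaussDensity_gaussMat nr n).prob
  obtain ⟨c, hc, h⟩ := exists_pi_sum_le_exp (gaussMat nr n) (measurable_log_gramDet (m := nr) (n := n))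
    (zero_mem_interior_integrableExpSet_log_gramDet hnr) hη
  refine ⟨c, hc, fun k => ?_⟩
  rw [integral_log_gramDet hnr] at h
  set M := ∑ i ∈ Finset.Icc (nr - n + 1) nr, digamma i
  have hprobk := (isGaussDensity_gaussBlk nr n k).prob
  let S : Set (Fin k → Fin nr → Fin n → ℂ) :=
    {H | ∏ i, gramDet (Matrix.of (H i)) ≤ Real.exp (k * (M - η))}
  have h1 : rayleighChannel n nr k (fadingEvent n nr k (Real.exp (k * (M - η)))) =
      ((gaussBlk nr n k).prod (gaussBlk nr n k)) (S ×ˢ Set.univ) := by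
    change ((gaussBlk nr n k).prod (gaussBlk nr n k)) _ = _
    congr 1
    ext p
    exact ⟨fun h => ⟨h, trivial⟩, fun h => h.1⟩
  rw [h1, Measure.prod_prod, measure_univ, mul_one]
  refine le_trans (measure_mono_ae ?_) (h k)
  have hae : ∀ᵐ H ∂gaussBlk nr n k, ∀ i, gramDet (Matrix.of (H i)) ≠ 0 :=
    ae_all_iff.2 fun i => (measurePreserving_eval (fun _ : Fin k => gaussMat nr n) i).quasiMeasurePreserving.ae
      (ae_gramDet_ne_zero hnr)
  filter_upwards [hae] with H hH hHS
  have hHS : ∏ i, gramDet (Matrix.of (H i)) ≤ Real.exp (k * (M - η)) := hHS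
  have hpos : 0 < ∏ i, gramDet (Matrix.of (H i)) :=
    Finset.prod_pos fun i _ => lt_of_le_of_ne (gramDet_nonneg _) (hH i).symm
  have := (Real.log_le_iff_le_exp hpos).2 hHS
  rwa [Real.log_prod fun i _ => hH i] at this

open Filter Topology in
/-- Stirling's upper bound for the factorial, in logarithmic form. -/
theorem eventually_log_factorial_le {δ : ℝ} (hδ : 0 < δ) :
    ∀ᶠ N : ℕ in atTop, Real.log (N.factorial : ℝ) ≤ N * (Real.log N - 1 + δ) := by
  have h1 : ∀ᶠ N : ℕ in atTop, Stirling.stirlingSeq N < √Real.pi + 1 :=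
    Stirling.tendsto_stirlingSeq_sqrt_pi.eventually_lt_const (lt_add_one _)
  have h2 : ∀ᶠ N : ℕ in atTop, Real.log (√Real.pi + 1) ≤ δ / 2 * N :=
    (tendsto_natCast_atTop_atTop.const_mul_atTop (by positivity)).eventually_ge_atTop _
  have h3 : ∀ᶠ N : ℕ in atTop, ‖Real.log (2 * N)‖ ≤ δ / 2 * ‖(2 * N : ℝ)‖ :=
    (tendsto_natCast_atTop_atTop.const_mul_atTop two_pos).eventually
      (Real.isLittleO_log_id_atTop.def (by positivity : 0 < δ / 2))
  filter_upwards [h1, h2, h3, eventually_ge_atTop 1] with N h1 h2 h3 hN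
  have hN0 : (0 : ℝ) < N := by exact_mod_cast hN
  have hpos : 0 < Stirling.stirlingSeq N := by
    obtain ⟨M, rfl⟩ : ∃ M, N = M + 1 := ⟨N - 1, by omega⟩
    exact Stirling.stirlingSeq'_pos M
  have h4 := Real.log_le_log hpos h1.le
  rw [Stirling.log_stirlingSeq_formula, Real.log_div hN0.ne' (Real.exp_pos 1).ne',
    Real.log_exp] at h4
  rw [Real.norm_eq_abs, Real.norm_of_nonneg (by positivity)] at h3
  have h5 := (le_abs_self _).trans h3
  nlinarith

open Filter in
theorem exists_ballConst_root_ge {n : ℕ} (hn : 1 ≤ n) {δ : ℝ} (hδ : 0 < δ) :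
    ∃ k₀ : ℕ, ∀ k, k₀ ≤ k → 1 ≤ k →
      Real.pi * Real.exp 1 / n * Real.exp (-δ) ≤ ballConst n k ^ (1 / ((n : ℝ) ^ 2 * k)) := by
  obtain ⟨k₀, h⟩ := eventually_atTop.1 (eventually_log_factorial_le hδ)
  refine ⟨k₀, fun k hk hk1 => ?_⟩
  have hn0 : (0 : ℝ) < n := by exact_mod_cast hn
  have hk0 : (0 : ℝ) < k := by exact_mod_cast hk1
  have hN := h (n ^ 2 * k) (hk.trans (Nat.le_mul_of_pos_left k (by positivity)))
  have hb := ballConst_pos k hn hk1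
  have hpi := Real.pi_pos
  have hlog : Real.log (Real.pi * Real.exp 1 / n * Real.exp (-δ)) =
      Real.log Real.pi + 1 - Real.log n - δ := by
    rw [Real.log_mul (by positivity) (Real.exp_pos _).ne', Real.log_div (by positivity) hn0.ne',
      Real.log_mul hpi.ne' (Real.exp_pos _).ne', Real.log_exp, Real.log_exp]
    ring
  rw [← Real.log_le_log_iff (by positivity) (by positivity), hlog, Real.log_rpow hb, ballConst,
    Real.log_div (by positivity) (by positivity), Real.log_pow, Real.log_mul (by positivity) hk0.ne',
    Real.log_mul hpi.ne' hn0.ne']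
  push_cast at hN ⊢
  rw [Real.log_mul (by positivity) hk0.ne', Real.log_pow] at hN
  rw [one_div, ← div_eq_inv_mul, le_div_iff₀ (by positivity)]
  push_cast at hN
  nlinarith

/-- Below the threshold rate the minimum distance of the faded lattice exceeds the noise. -/
theorem distance_condition {n k : ℕ} (hn : 1 ≤ n) (hk : 1 ≤ k) {P CL R M g : ℝ} (hP : 0 < P)
    (hCL : 0 < CL) (L : FullLattice n k) (hvol : L.vol ^ (1 / ((n : ℝ) ^ 2 * k)) ≤ CL)
    (hg : g = M + n * Real.log (P / n) - n * Real.log CL +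
      n * Real.log (Real.pi * Real.exp 1 / (4 * n)) - R * Real.log 2)
    (hball : Real.pi * Real.exp 1 / n * Real.exp (-(g / (3 * n))) ≤
      ballConst n k ^ (1 / ((n : ℝ) ^ 2 * k))) :
    4 * ((n : ℝ) ^ 2 * k * Real.exp (g / (3 * n))) ≤
      (n * k : ℝ) * Real.exp (k * (M - g / 3)) ^ (1 / (n * k : ℝ)) * L.scale P R ^ 2 := by
  have hn0 : (0 : ℝ) < n := by exact_mod_cast hn
  have hk0 : (0 : ℝ) < k := by exact_mod_cast hk
  have hpi := Real.pi_pos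
  have hv := L.vol_pos hn hk
  have hroot : Real.exp (k * (M - g / 3)) ^ (1 / (n * k : ℝ)) = Real.exp ((M - g / 3) / n) := by
    rw [← Real.exp_mul]
    congr 1
    field_simp
  have hscale : Real.pi * Real.exp 1 / n * Real.exp (-(g / (3 * n))) * P / ((2 : ℝ) ^ (R / n) * CL) ≤
      L.scale P R ^ 2 := by
    have hb := ballConst_pos k hn hk
    rw [L.scale_sq hn hk hP]
    gcongr
  have hmain : 4 * n * Real.exp (g / (3 * n)) = Real.exp ((M - g / 3) / n) *
      (Real.pi * Real.exp 1 / n * Real.exp (-(g / (3 * n))) * P / ((2 : ℝ) ^ (R / n) * CL)) := by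
    apply Real.log_injOn_pos (Set.mem_Ioi.2 (by positivity)) (Set.mem_Ioi.2 (by positivity))
    rw [Real.log_div hP.ne' hn0.ne', Real.log_div (by positivity) (by positivity),
      Real.log_mul hpi.ne' (Real.exp_pos _).ne', Real.log_exp,
      Real.log_mul (by norm_num) hn0.ne'] at hg
    rw [Real.log_mul (by positivity) (Real.exp_pos _).ne', Real.log_mul (by norm_num) hn0.ne',
      Real.log_exp, Real.log_mul (Real.exp_pos _).ne' (by positivity), Real.log_exp,
      Real.log_div (by positivity) (by positivity), Real.log_mul (by positivity) hP.ne',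
      Real.log_mul (by positivity) (Real.exp_pos _).ne', Real.log_exp,
      Real.log_div (by positivity) hn0.ne', Real.log_mul hpi.ne' (Real.exp_pos _).ne', Real.log_exp,
      Real.log_mul (by positivity) hCL.ne', Real.log_rpow two_pos]
    field_simp
    linarith
  rw [hroot]
  calc 4 * ((n : ℝ) ^ 2 * k * Real.exp (g / (3 * n)))
      = n * k * (4 * n * Real.exp (g / (3 * n))) := by ring
    _ = n * k * Real.exp ((M - g / 3) / n) * (Real.pi * Real.exp 1 / n *
        Real.exp (-(g / (3 * n))) * P / ((2 : ℝ) ^ (R / n) * CL)) := by rw [hmain]; ring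
    _ ≤ _ := by gcongr

theorem exists_errorProb_le_exp {n nr : ℕ} (hn : 1 ≤ n) (hnr : n ≤ nr) {P CL R : ℝ} (hP : 0 < P)
    (hCL : 0 < CL) (hR : R < (∫ H, logDet P H ∂(gaussianMatrix nr n)) - n * Real.logb 2 CL +
      n * Real.logb 2 (Real.pi * Real.exp 1 / (4 * n))) :
    ∃ A c : ℝ, 0 < c ∧ ∀ k, 1 ≤ k → ∀ L : FullLattice n k, L.mindet = 1 →
      L.vol ^ (1 / ((n : ℝ) ^ 2 * k)) ≤ CL → ∀ shift : Blocks n n k, ∀ dec : Decoder n nr k,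
        IsMLDecoder (L.code P R shift) dec ∨ IsNaiveDecoder (L.coset P R shift) dec →
          errorProb (L.code P R shift) dec ≤ ENNReal.ofReal (A * Real.exp (-c * k)) := by
  have hn0 : (0 : ℝ) < n := by exact_mod_cast hn
  set M := ∑ i ∈ Finset.Icc (nr - n + 1) nr, digamma i with hM
  set g := M + n * Real.log (P / n) - n * Real.log CL +
      n * Real.log (Real.pi * Real.exp 1 / (4 * n)) - R * Real.log 2 with hg
  have hgpos : 0 < g := by
    have hl := Real.log_pos one_lt_two
    rw [integral_logDet hn hnr hP, ← hM] at hR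
    have := mul_lt_mul_of_pos_right hR hl
    simp only [Real.logb, add_mul, sub_mul] at this
    rw [div_mul_cancel₀ _ hl.ne', mul_assoc, div_mul_cancel₀ _ hl.ne', mul_assoc,
      div_mul_cancel₀ _ hl.ne'] at this
    linarith
  set r := Real.exp (g / (3 * n)) with hr
  have hr1 : 1 < r := Real.one_lt_exp_iff.2 (by positivity)
  obtain ⟨c₂, hc₂, hfade⟩ := exists_fadingEvent_le_exp hnr (by positivity : 0 < g / 3)
  obtain ⟨k₀, hball⟩ := exists_ballConst_root_ge hn (by positivity : 0 < g / (3 * n))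
  set c₁ := n ^ 2 * (r - 1 - Real.log r) with hc₁
  have hc₁pos : 0 < c₁ := by
    have := Real.log_lt_sub_one_of_pos (by linarith : 0 < r) hr1.ne'
    have h2 : 0 < r - 1 - Real.log r := by linarith
    positivity
  set c := min c₁ c₂ with hc
  have hcpos : 0 < c := lt_min hc₁pos hc₂
  refine ⟨2 + Real.exp (c * k₀), c, hcpos, fun k hk L hL hvol shift dec hdec => ?_⟩
  rcases le_or_gt k₀ k with hkk | hkk
  · have herr := errorProb_le hn hk hP hL hdec (Real.exp_pos (k * (M - g / 3))).le
      (distance_condition hn hk hP hCL L hvol hg (hball k hkk hk))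
    refine herr.trans ((add_le_add (rayleighChannel_noiseEvent_le_exp n nr k hr1) (hfade k)).trans ?_)
    rw [← ENNReal.ofReal_add (Real.exp_pos _).le (Real.exp_pos _).le]
    refine ENNReal.ofReal_le_ofReal ?_
    have e1 : Real.exp (-c₁ * k) ≤ Real.exp (-c * k) := by
      gcongr; exact min_le_left _ _
    have e2 : Real.exp (-c₂ * k) ≤ Real.exp (-c * k) := by
      gcongr; exact min_le_right _ _
    have e3 : 0 < Real.exp (c * k₀) * Real.exp (-c * k) := by positivity
    linarith
  · refine (errorProb_le_one _ dec).trans ?_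
    rw [← ENNReal.ofReal_one]
    refine ENNReal.ofReal_le_ofReal ?_
    have h1 : (k : ℝ) ≤ k₀ := by exact_mod_cast hkk.le
    have h2 : 1 ≤ Real.exp (c * k₀) * Real.exp (-c * k) := by
      rw [← Real.exp_add]
      exact Real.one_le_exp (by nlinarith)
    have h3 : 0 < Real.exp (-c * k) := Real.exp_pos _
    linarith

end Multiblock

end

theorem mainTheorem5 (n nr : ℕ) (hn : 1 ≤ n) (hnr : n ≤ nr) (P CL : ℝ) (hP : 0 < P) (hCL : 0 < CL)
    (K : Set ℕ) (hK : ∀ k ∈ K, 1 ≤ k) (L : ∀ k : ℕ, Multiblock.FullLattice n k)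
    (hdet : ∀ k ∈ K, (L k).mindet = 1)
    (hvol : ∀ k ∈ K, (L k).vol ^ (1 / ((n : ℝ) ^ 2 * k)) ≤ CL) :
    -- the expectation of `log₂ det ((P/n) H† H)` exists and has the closed form
    (Integrable (Multiblock.logDet P) (Multiblock.gaussianMatrix nr n) ∧
      ∫ H, Multiblock.logDet P H ∂(Multiblock.gaussianMatrix nr n) =
        n * Real.logb 2 (P / n * Real.exp (1 / n *
          ∑ i ∈ Finset.Icc (nr - n + 1) nr, Multiblock.digamma i))) ∧
    -- every rate below the threshold is achieved, with exponentially small error probability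
    ∀ R : ℝ,
      R < (∫ H, Multiblock.logDet P H ∂(Multiblock.gaussianMatrix nr n))
          - n * Real.logb 2 CL + n * Real.logb 2 (Real.pi * Real.exp 1 / (4 * n)) →
      (∀ k ∈ K, ∃ shift : Multiblock.Blocks n n k,
        Multiblock.RateAtLeast R ((L k).code P R shift)) ∧
      (∀ k ∈ K, ∀ shift : Multiblock.Blocks n n k,
        Multiblock.PowerConstraint P ((L k).code P R shift)) ∧
      ∃ A c : ℝ, 0 < c ∧ ∀ k ∈ K, ∀ shift : Multiblock.Blocks n n k,
        ∀ dec : Multiblock.Decoder n nr k,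
          Multiblock.IsMLDecoder ((L k).code P R shift) dec ∨
            Multiblock.IsNaiveDecoder ((L k).coset P R shift) dec →
          Multiblock.errorProb ((L k).code P R shift) dec ≤
            ENNReal.ofReal (A * Real.exp (-c * k)) := by
  refine ⟨⟨Multiblock.integrable_logDet hn hnr hP, Multiblock.integral_logDet_eq_logb hn hnr hP⟩,
    fun R hR => ⟨fun k hk => (L k).exists_rateAtLeast hn (hK k hk) hP R,
      fun k hk shift => Multiblock.powerConstraint_code hn (hK k hk) hP R (L k) shift, ?_⟩⟩
  obtain ⟨A, c, hc, h⟩ := Multiblock.exists_errorProb_le_exp hn hnr hP hCL hR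
  exact ⟨A, c, hc, fun k hk shift dec hdec =>
    h k (hK k hk) (L k) (hdet k hk) (hvol k hk) shift dec hdec⟩
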